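/- Let $n\ge 1$ and $\mu>0$. On $\mathbb{C}^{n+1}$ let $\hat h(X,Y)=\sum_{j=1}^{n-1}\overline{Y_j}X_j+\overline{Y_{n+1}}X_n+\overline{Y_n}X_{n+1}$, and let $\mathbb{C}\mathrm{H}(n)=\{[z]\in\mathbb{C}P^n:\hat h(z,z)<0\}$ carry the Riemannian metric $g$ and the Kähler form $\omega$ induced by $\mathrm{Re}\,\hat h$ and $\mathrm{Im}\,\hat h$ through the isomorphisms $\pi_*:\{X:\hat h(X,z)=0\}\to T_{[z]}\mathbb{C}\mathrm{H}(n)$, $\hat h(z,z)=-\mu$. Fix the base point $o=[0:\dots:0:1:-1]$. Let $N=\exp\mathfrak n$, where $\mathfrak n=\mathfrak n_1+\mathbb{R}N_2$ and, in block form with blocks of size $n-1,1,1$, $$\mathfrak n_1=\left\{\begin{pmatrix}0&0&v\\-v^*&0&0\\0&0&0\end{pmatrix}:v\in\mathbb{C}^{n-1}\right\},\quad N_2=\begin{pmatrix}0&0&0\\0&0&i\\0&0&0\end{pmatrix},\quad A_0=\mathrm{diag}(0,\dots,0,1,-1).$$ Let $F_r$ be a connected closed subgroup of $\mathrm{S}(\mathrm{U}(n-1)\mathrm{U}(1))\mathbb{R}=\{\mathrm{diag}(U,e^t\zeta,e^{-t}\zeta):U\in\mathrm{U}(n-1),\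 |\zeta|=1,\ \det(U)\zeta^2=1,\ t\in\mathbb{R}\}$ with non-trivial projection to $\mathbb{R}$. Put $G=F_rN$ and $H=F_r\cap \mathrm{S}(\mathrm{U}(n-1)\mathrm{U}(1))$ (the elements with $t=0$), so that $\mathbb{C}\mathrm{H}(n)=G/H$, with Lie algebras $\mathfrak g,\mathfrak h$, and let $\mathfrak f_r$ be the Lie algebra of $F_r$. Let $\mathfrak g=\mathfrak h\oplus\mathfrak m$ with $\mathrm{Ad}(H)\mathfrak m\subset\mathfrak m$. For a matrix $B$ let $B^*$ be the vector field $B^*_p=\frac{d}{dt}\big|_{0}\exp(tB)p$. Let $\nabla$ be the Levi-Civita connection of $g$, let $\tilde\nabla$ be the canonical connection of the decomposition (the $G$-invariant affine connection with $(\tilde\nabla_{B^*}C^*)_o=-([B,C]_{\mathfrak m})^*_o$ for $B,C\in\mathfrak m$), and let $S=\nabla-\tilde\nabla$. Let $H_r\in\mathfrak s(\mathfrak u(n-1)+\mathfrak u(1))$ (the Lie algebra of $\mathrm{S}(\mathrm{U}(n-1)\mathrm{U}(1))$) be the element for which $A_r=A_0+H_r$ lies in $\mathfrak f_r$ and is orthogonal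 to $\mathfrak h$ with respect to $\mathrm{Re}\,\mathrm{tr}(E^*E')$. Let $\chi_r:\mathbb{R}A_0+\mathfrak n\to\mathbb{R}A_r+\mathfrak n$ be the linear map that is the identity on $\mathfrak n$ and maps $A_0$ to $A_r$, let $\varphi:\mathbb{R}A_0+\mathfrak n\to\mathfrak h$ be the map with $\chi_r(X)+\varphi(X)\in\mathfrak m$ for all $X$, and put $\tilde X=\chi_r(X)+\varphi(X)$. Then $B\mapsto B^*_o$ is a bijection $\mathfrak m\to T_o\mathbb{C}\mathrm{H}(n)$, and every $B\in\mathfrak m$ is $$B=\alpha_B\tilde A_0+\eta_B\tilde N_2+\tilde X_B,$$ where $\alpha_B$ is the real part of the $(n,n)$ entry of $B$, $\eta_B$ is the imaginary part of its $(n,n+1)$ entry, and $X_B\in\mathfrak n_1$ is the element whose vector $v$ is given by the first $n-1$ entries of the last column of $B$. Identify $\mathfrak m$ with $T_o\mathbb{C}\mathrm{H}(n)$, let $J$ be the complex structure on $\mathfrak m$, $\omega(X,Y)=g(X,JY)$, and put $B'=\alpha_B\varphi(A_0)+\eta_B\varphi(N_2)+\varphi(X_B)$ and $B_r=\widetilde{[H_r,X_B]}$.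 Then, for all $B,C,D\in\mathfrak m$, $$\begin{aligned}g(S_BC,D)={}&\alpha_D\,g(B,C)-\alpha_C\,g(B,D)+\alpha_{JD}\,g(B,JC)-\alpha_{JC}\,g(B,JD)\\&-\alpha_{JB}\,\omega(\tilde X_C,\tilde X_D)+g([B',C],D)+\alpha_B\,g(C_r,D).\end{aligned}$$ -/

import Mathlib

open scoped Manifold ComplexConjugate Matrix

noncomputable section

/-! ## Matrices and the hermitian form

Throughout, `CH(n)` is the complex hyperbolic space with `n = m + 1`, `m ≥ 0`.  The coordinates of
`ℂ^(n+1)` are indexed by `Fin m ⊕ Fin 2`: `Sum.inl i` are the first `n - 1` coordinates, `last₀`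
is the `n`-th coordinate and `last₁` the `(n+1)`-st one. -/

namespace CHyp

/-- Complex square matrices of size `n + 1 = m + 2`. -/
abbrev Mat (m : ℕ) : Type := Matrix (Fin m ⊕ Fin 2) (Fin m ⊕ Fin 2) ℂ

/-- The group `GL(n + 1, ℂ)`. -/
abbrev GLn (m : ℕ) : Type := (Mat m)ˣ

/-- The vector space `ℂ^(n+1)`. -/
abbrev Vec (m : ℕ) : Type := Fin m ⊕ Fin 2 → ℂ

abbrev last₀ {m : ℕ} : Fin m ⊕ Fin 2 := Sum.inr 0
abbrev last₁ {m : ℕ} : Fin m ⊕ Fin 2 := Sum.inr 1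

/-- The hermitian form
`ĥ(X, Y) = conj Y₁ X₁ + ⋯ + conj Yₙ₋₁ Xₙ₋₁ + conj Yₙ₊₁ Xₙ + conj Yₙ Xₙ₊₁`. -/
def herm {m : ℕ} (X Y : Vec m) : ℂ :=
  (∑ i : Fin m, conj (Y (Sum.inl i)) * X (Sum.inl i))
    + conj (Y last₁) * X last₀ + conj (Y last₀) * X last₁

/-! ## Complex hyperbolic space: the Siegel domain -/

/-- The affine chart `{z : z_{n+1} ≠ 0}` of `ℂPⁿ`, with values in `ℂ^(n-1) × ℂ`. -/
abbrev Chart (m : ℕ) : Type := (Fin m → ℂ) × ℂ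

/-- The projection `ℂ^(n+1) ∖ {0} → ℂPⁿ`, read in the affine chart. -/
def toChart {m : ℕ} (z : Vec m) : Chart m :=
  (fun i => z (Sum.inl i) / z last₁, z last₀ / z last₁)

/-- The homogeneous coordinates `(w, u, 1)` of the point `p = (w, u)`. -/
def homog {m : ℕ} (p : Chart m) : Vec m := Sum.elim p.1 ![p.2, 1]

/-- `CH(n) = π {z : ĥ(z, z) < 0}`.  A vector with `ĥ(z, z) < 0` has `z_{n+1} ≠ 0`, so that all of
`CH(n)` lies in the affine chart, where it is an open set, the Siegel domain
`{(w, u) : ‖w‖² + 2 Re u < 0}`. -/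
def siegel (m : ℕ) : Set (Chart m) := {p | (herm (homog p) (homog p)).re < 0}

/-- The point over `p` of the anti-de Sitter space `H(μ) = {z : ĥ(z, z) = -μ}`
whose last coordinate is positive. -/
def lift {m : ℕ} (μ : ℝ) (p : Chart m) : Vec m :=
  √(μ / -(herm (homog p) (homog p)).re) • homog p

/-- The horizontal lift of a tangent vector `v` at `p`: the only `X` in
`T'_z = {X : ĥ(X, z) = 0}`, `z = lift μ p`, that the differential of the projection maps to `v`.
It is the projection to `T'_z` of `z_{n+1} • (v, 0)`, which is mapped to `v`. -/
def horLift {m : ℕ} (μ : ℝ) (p v : Chart m) : Vec m :=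
  let z := lift μ p
  let X : Vec m := z last₁ • Sum.elim v.1 ![v.2, 0]
  X - (herm X z / herm z z) • z

/-- The Riemannian metric of `CH(n)` (holomorphic sectional curvature `-4/μ`) at `p`. -/
def metric {m : ℕ} (μ : ℝ) (p v w : Chart m) : ℝ :=
  (herm (horLift μ p v) (horLift μ p w)).re

/-- The Kähler form of `CH(n)` at `p`. -/
def kaehlerForm {m : ℕ} (μ : ℝ) (p v w : Chart m) : ℝ :=
  (herm (horLift μ p v) (horLift μ p w)).im

/-- The base point `o = [0 : ⋯ : 0 : 1 : -1]`. -/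
def basePt (m : ℕ) : Chart m := (0, -1)

/-- The action of matrices on `CH(n)`. -/
def act {m : ℕ} (g : Mat m) (p : Chart m) : Chart m := toChart (g *ᵥ homog p)

/-- The infinitesimal generator `B*` on `CH(n)` of a matrix `B`:
`B*_p` is the velocity at `t = 0` of `exp(tB) · p`. -/
def fundField {m : ℕ} (B : Mat m) (p : Chart m) : Chart m :=
  deriv (fun t : ℝ => act (NormedSpace.exp (t • B)) p) 0

/-! ## Groups and Lie algebras -/

/-- The Lie algebra of a closed subgroup `K` of `GL(n + 1, ℂ)`: the velocities at `t = 0` of the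
curves in `K` through the identity. -/
def lieAlg {m : ℕ} (K : Subgroup (GLn m)) : Submodule ℝ (Mat m) where
  carrier := {X | ∃ γ : ℝ → GLn m, (∀ t, γ t ∈ K) ∧ γ 0 = 1 ∧
    ∀ i j, HasDerivAt (fun t => (γ t : Mat m) i j) (X i j) 0}
  zero_mem' := ⟨fun _ => 1, fun _ => K.one_mem, rfl, fun i j => by
    simpa using hasDerivAt_const (0 : ℝ) ((1 : Mat m) i j)⟩
  add_mem' := by
    rintro X Y ⟨γ, hγ, hγ0, hX⟩ ⟨δ, hδ, hδ0, hY⟩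
    refine ⟨fun t => γ t * δ t, fun t => K.mul_mem (hγ t) (hδ t), by simp [hγ0, hδ0], ?_⟩
    intro i j
    have h := HasDerivAt.fun_sum (u := Finset.univ) fun k _ => (hX i k).mul (hY k j)
    simp only [hγ0, hδ0, Units.val_one] at h
    rw [Finset.sum_add_distrib, ← Matrix.mul_apply, ← Matrix.mul_apply, mul_one, one_mul] at h
    simpa only [Units.val_mul, Matrix.mul_apply, Matrix.add_apply, Pi.mul_apply] using h
  smul_mem' := by
    rintro c X ⟨γ, hγ, hγ0, hX⟩
    refine ⟨fun t => γ (c * t), fun t => hγ _, by simp [hγ0], ?_⟩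
    intro i j
    have h0 : HasDerivAt (fun t : ℝ => c * t) c 0 := by
      simpa using (hasDerivAt_id (0 : ℝ)).const_mul c
    have h1 : HasDerivAt (fun t => (γ t : Mat m) i j) (X i j) (c * 0) := by simpa using hX i j
    exact h1.scomp (0 : ℝ) h0

/-- The matrix `diag(U, e^t ζ, e^(-t) ζ)`. -/
def maMat {m : ℕ} (U : Matrix (Fin m) (Fin m) ℂ) (ζ : ℂ) (t : ℝ) : Mat m :=
  Matrix.fromBlocks U 0 0 !![Real.exp t * ζ, 0; 0, Real.exp (-t) * ζ]

lemma maMat_mul {m : ℕ} (U V : Matrix (Fin m) (Fin m) ℂ) (ζ ξ : ℂ) (s t : ℝ) :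
    maMat U ζ s * maMat V ξ t = maMat (U * V) (ζ * ξ) (s + t) := by
  simp only [maMat, Matrix.fromBlocks_multiply]
  congr 1
  · simp
  · simp
  · simp
  · ext i j
    fin_cases i <;> fin_cases j <;> simp [Real.exp_add] <;> ring

lemma maMat_one {m : ℕ} : maMat (1 : Matrix (Fin m) (Fin m) ℂ) 1 0 = 1 := by
  rw [maMat, ← Matrix.fromBlocks_one]
  congr 1
  ext i j
  fin_cases i <;> fin_cases j <;> simp

/-- The group `S(U(n-1)U(1)) ℝ` of the matrices `diag(U, e^t ζ, e^(-t) ζ)` with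
`U ∈ U(n-1)`, `|ζ| = 1`, `det U · ζ² = 1` and `t ∈ ℝ`. -/
def groupMA (m : ℕ) : Subgroup (GLn m) where
  carrier := {g | ∃ U ∈ Matrix.unitaryGroup (Fin m) ℂ, ∃ ζ : ℂ, ∃ t : ℝ,
    ‖ζ‖ = 1 ∧ U.det * ζ ^ 2 = 1 ∧ (g : Mat m) = maMat U ζ t}
  one_mem' := ⟨1, one_mem _, 1, 0, by simp, by simp, by simp [maMat_one]⟩
  mul_mem' := by
    rintro g h ⟨U, hU, ζ, s, hζ, hd, hg⟩ ⟨V, hV, ξ, t, hξ, he, hh⟩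
    refine ⟨U * V, mul_mem hU hV, ζ * ξ, s + t, by simp [hζ, hξ], ?_, ?_⟩
    · rw [Matrix.det_mul]; linear_combination V.det * ξ ^ 2 * hd + he
    · rw [Units.val_mul, hg, hh, maMat_mul]
  inv_mem' := by
    rintro g ⟨U, hU, ζ, s, hζ, hd, hg⟩
    have hζ0 : ζ ≠ 0 := by rintro rfl; simp at hζ
    have hUU : U * star U = 1 := (Matrix.mem_unitaryGroup_iff).1 hU
    have hdet : U.det * (star U).det = 1 := by rw [← Matrix.det_mul, hUU, Matrix.det_one]
    refine ⟨star U, Unitary.star_mem hU, ζ⁻¹, -s, by simp [hζ], ?_, ?_⟩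
    · field_simp
      linear_combination (star U).det * (-hd) * 1 + ζ ^ 2 * hdet
    · refine Units.inv_eq_of_mul_eq_one_right ?_
      rw [hg, maMat_mul, hUU, mul_inv_cancel₀ hζ0, add_neg_cancel, maMat_one]

/-- The group `S(U(n-1)U(1))`: the matrices in `S(U(n-1)U(1)) ℝ` with trivial factor in `ℝ`. -/
def groupM (m : ℕ) : Subgroup (GLn m) where
  carrier := {g | ∃ U ∈ Matrix.unitaryGroup (Fin m) ℂ, ∃ ζ : ℂ,
    ‖ζ‖ = 1 ∧ U.det * ζ ^ 2 = 1 ∧ (g : Mat m) = maMat U ζ 0}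
  one_mem' := ⟨1, one_mem _, 1, by simp, by simp, by simp [maMat_one]⟩
  mul_mem' := by
    rintro g h ⟨U, hU, ζ, hζ, hd, hg⟩ ⟨V, hV, ξ, hξ, he, hh⟩
    refine ⟨U * V, mul_mem hU hV, ζ * ξ, by simp [hζ, hξ], ?_, ?_⟩
    · rw [Matrix.det_mul]; linear_combination V.det * ξ ^ 2 * hd + he
    · rw [Units.val_mul, hg, hh, maMat_mul, add_zero]
  inv_mem' := by
    rintro g ⟨U, hU, ζ, hζ, hd, hg⟩
    have hζ0 : ζ ≠ 0 := by rintro rfl; simp at hζ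
    have hUU : U * star U = 1 := (Matrix.mem_unitaryGroup_iff).1 hU
    have hdet : U.det * (star U).det = 1 := by rw [← Matrix.det_mul, hUU, Matrix.det_one]
    refine ⟨star U, Unitary.star_mem hU, ζ⁻¹, by simp [hζ], ?_, ?_⟩
    · field_simp
      linear_combination (star U).det * (-hd) * 1 + ζ ^ 2 * hdet
    · refine Units.inv_eq_of_mul_eq_one_right ?_
      rw [hg, maMat_mul, hUU, mul_inv_cancel₀ hζ0, add_zero, maMat_one]

/-- The element `a A₀ + b N₂ + X_v` of `𝔰 = 𝔞 + 𝔫`, with rows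
`(0, 0, v)`, `(-v*, a, ib)`, `(0, 0, -a)`. -/
def sMat {m : ℕ} (a b : ℝ) (v : Fin m → ℂ) : Mat m :=
  Matrix.fromBlocks 0 (Matrix.of fun i => ![0, v i])
    (Matrix.of ![fun j => -conj (v j), fun _ => 0]) !![(a : ℂ), b * Complex.I; 0, -a]

/-- `A₀ = diag(0, …, 0, 1, -1)`, a generator of `𝔞`. -/
def A₀ (m : ℕ) : Mat m := sMat 1 0 0

/-- The generator `N₂` of `𝔫₂`. -/
def N₂ (m : ℕ) : Mat m := sMat 0 1 0

/-- The nilpotent group `N = exp 𝔫`, where `𝔫 = 𝔫₁ + 𝔫₂` consists of the matrices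
`sMat 0 b v = b N₂ + X_v`, whose cubes vanish. -/
def groupN (m : ℕ) : Subgroup (GLn m) :=
  Subgroup.closure {g | ∃ (b : ℝ) (v : Fin m → ℂ), (g : Mat m) = NormedSpace.exp (sMat 0 b v)}

/-- The subgroups `F` of `S(U(n-1)U(1)) ℝ` for which `F N` acts transitively on `CH(n)`: connected,
closed, and with non-trivial projection to `ℝ`. -/
structure IsTransitiveFactor {m : ℕ} (F : Subgroup (GLn m)) : Prop where
  le : F ≤ groupMA m
  isClosed : IsClosed (F : Set (GLn m))
  isConnected : IsConnected (F : Set (GLn m))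
  nontrivial : ¬ F ≤ groupM m

/-- `G = F N`. -/
def groupG {m : ℕ} (F : Subgroup (GLn m)) : Subgroup (GLn m) := F ⊔ groupN m

/-- `H = F ∩ S(U(n-1)U(1))`. -/
def groupH {m : ℕ} (F : Subgroup (GLn m)) : Subgroup (GLn m) := F ⊓ groupM m

/-- `𝔪` is a reductive complement: `𝔤 = 𝔥 ⊕ 𝔪` and `Ad(H) 𝔪 ⊆ 𝔪`. -/
structure IsReductiveComplement {m : ℕ} (F : Subgroup (GLn m)) (𝔪 : Submodule ℝ (Mat m)) :
    Prop where
  sup_eq : lieAlg (groupH F) ⊔ 𝔪 = lieAlg (groupG F)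
  inf_eq : lieAlg (groupH F) ⊓ 𝔪 = ⊥
  ad_mem : ∀ h ∈ groupH F, ∀ X ∈ 𝔪, (h : Mat m) * X * ((h⁻¹ : GLn m) : Mat m) ∈ 𝔪

/-- The component `X_𝔪` in `𝔪` of `X ∈ 𝔥 ⊕ 𝔪`. -/
def projM {m : ℕ} (F : Subgroup (GLn m)) (𝔪 : Submodule ℝ (Mat m)) (X : Mat m) : Mat m :=
  Classical.epsilon fun Z => Z ∈ 𝔪 ∧ X - Z ∈ lieAlg (groupH F)

/-! ## Connections -/

/-- The type of the operators `(∇, Y, p, v) ↦ (∇_v Y)_p`, with Mathlib's order of arguments. -/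
abbrev Cov (m : ℕ) : Type :=
  (Π p : Chart m, TangentSpace 𝓘(ℝ, Chart m) p) →
    (Π p : Chart m, TangentSpace 𝓘(ℝ, Chart m) p →L[ℝ] TangentSpace 𝓘(ℝ, Chart m) p)

/-- `∇` is an affine connection on `CH(n)`. -/
def IsConnection {m : ℕ} (cov : Cov m) : Prop :=
  IsCovariantDerivativeOn (I := 𝓘(ℝ, Chart m)) (Chart m)
    (V := fun p : Chart m => TangentSpace 𝓘(ℝ, Chart m) p) cov (siegel m)

/-- `∇` is the Levi-Civita connection of `CH(n)`: torsion-free and metric. -/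
structure IsLeviCivita {m : ℕ} (μ : ℝ) (cov : Cov m) : Prop where
  isConnection : IsConnection cov
  torsion_free : ∀ X Y : Chart m → Chart m, ∀ p ∈ siegel m,
    DifferentiableAt ℝ X p → DifferentiableAt ℝ Y p →
      cov Y p (X p) - cov X p (Y p) = VectorField.lieBracket ℝ X Y p
  compatible : ∀ Y Z : Chart m → Chart m, ∀ p ∈ siegel m,
    DifferentiableAt ℝ Y p → DifferentiableAt ℝ Z p → ∀ v : Chart m,
      fderiv ℝ (fun q => metric μ q (Y q) (Z q)) p v
        = metric μ p (cov Y p v) (Z p) + metric μ p (Y p) (cov Z p v)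

/-- `∇̃` is the canonical connection of the reductive decomposition `𝔤 = 𝔥 + 𝔪` of
`CH(n) = G/H`: the `G`-invariant affine connection with `(∇̃_{B*} C*)_o = -([B, C]_𝔪)*_o` for
`B, C ∈ 𝔪`. -/
structure IsCanonicalConnection {m : ℕ} (F : Subgroup (GLn m)) (𝔪 : Submodule ℝ (Mat m))
    (cov : Cov m) : Prop where
  isConnection : IsConnection cov
  invariant : ∀ g ∈ groupG F, ∀ Y : Chart m → Chart m, ∀ p ∈ siegel m,
    DifferentiableAt ℝ Y (act (g : Mat m) p) → ∀ v : Chart m,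
      fderiv ℝ (act (g : Mat m)) p (cov (VectorField.pullback ℝ (act (g : Mat m)) Y) p v)
        = cov Y (act (g : Mat m) p) (fderiv ℝ (act (g : Mat m)) p v)
  at_base : ∀ B ∈ 𝔪, ∀ C ∈ 𝔪,
    cov (fundField C) (basePt m) (fundField B (basePt m))
      = -fundField (projM F 𝔪 ⁅B, C⁆) (basePt m)

/-- The homogeneous structure tensor `S = ∇ - ∇̃`: `structureTensor h h' p v w = (S_v w)_p`. -/
def structureTensor {m : ℕ} {cov cov' : Cov m} (h : IsConnection cov) (h' : IsConnection cov')
    (p v w : Chart m) : Chart m :=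
  IsCovariantDerivativeOn.difference (I := 𝓘(ℝ, Chart m)) (F := Chart m)
    (V := fun p : Chart m => TangentSpace 𝓘(ℝ, Chart m) p) h h' p w v

/-! ## Notation on `𝔪` -/

/-- The value `B*_o` at the base point of the generator of `B`; it identifies `𝔪` with `T_o`. -/
def ev {m : ℕ} (B : Mat m) : Chart m := fundField B (basePt m)

/-- The metric on `𝔪 ≅ T_o`. -/
def gm {m : ℕ} (μ : ℝ) (B C : Mat m) : ℝ := metric μ (basePt m) (ev B) (ev C)

/-- The Kähler form on `𝔪 ≅ T_o`. -/
def om {m : ℕ} (μ : ℝ) (B C : Mat m) : ℝ := kaehlerForm μ (basePt m) (ev B) (ev C)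

/-- The complex structure on `𝔪`: `J B` is the element of `𝔪` with `ω(X, B) = g(X, J B)` for all
`X ∈ 𝔪`. -/
def Jm {m : ℕ} (μ : ℝ) (𝔪 : Submodule ℝ (Mat m)) (B : Mat m) : Mat m :=
  Classical.epsilon fun Z => Z ∈ 𝔪 ∧ ∀ X ∈ 𝔪, om μ X B = gm μ X Z

/-- The coefficient `α_B`. -/
def coefα {m : ℕ} (B : Mat m) : ℝ := (B last₀ last₀).re

/-- The coefficient `η_B`. -/
def coefη {m : ℕ} (B : Mat m) : ℝ := (B last₀ last₁).im

/-- The component `X_B ∈ 𝔫₁`. -/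
def compX {m : ℕ} (B : Mat m) : Mat m := sMat 0 0 fun i => B (Sum.inl i) last₁

/-- The inner product `k(E, E') = Re tr(E* E')`. -/
def innerK {m : ℕ} (E E' : Mat m) : ℝ := (Matrix.trace (Eᴴ * E')).re

/-- `Hr` is the element of `𝔰(𝔲(n-1) + 𝔲(1))` for which `A_r = A₀ + Hr` lies in the Lie algebra
`𝔣` of `F` and is `k`-orthogonal to `𝔥`; thus `ℝ A_r` is the `k`-orthogonal complement of
`𝔥` in `𝔣`. -/
structure IsHr {m : ℕ} (F : Subgroup (GLn m)) (Hr : Mat m) : Prop where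
  mem : Hr ∈ lieAlg (groupM m)
  add_mem : A₀ m + Hr ∈ lieAlg F
  orthogonal : ∀ Z ∈ lieAlg (groupH F), innerK (A₀ m + Hr) Z = 0

/-- The map `χ_r : 𝔰 → 𝔰_r` that is the identity on `𝔫` and maps `A₀` to `A_r = A₀ + Hr`. -/
def chi {m : ℕ} (Hr X : Mat m) : Mat m := X + coefα X • Hr

/-- The map `φ : 𝔰 → 𝔥` of which `𝔪` is the graph: `χ_r X + φ X ∈ 𝔪`. -/
def phi {m : ℕ} (F : Subgroup (GLn m)) (𝔪 : Submodule ℝ (Mat m)) (Hr X : Mat m) : Mat m :=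
  Classical.epsilon fun U => U ∈ lieAlg (groupH F) ∧ chi Hr X + U ∈ 𝔪

/-- `X̃ = χ_r X + φ X`, for `X ∈ 𝔰`. -/
def tilde {m : ℕ} (F : Subgroup (GLn m)) (𝔪 : Submodule ℝ (Mat m)) (Hr X : Mat m) : Mat m :=
  chi Hr X + phi F 𝔪 Hr X

/-- `B' = α_B φ(A₀) + η_B φ(N₂) + φ(X_B)`. -/
def primeOf {m : ℕ} (F : Subgroup (GLn m)) (𝔪 : Submodule ℝ (Mat m)) (Hr B : Mat m) : Mat m :=
  coefα B • phi F 𝔪 Hr (A₀ m) + coefη B • phi F 𝔪 Hr (N₂ m) + phi F 𝔪 Hr (compX B)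

/-- `B_r`, the image of `[Hr, X_B] ∈ 𝔫₁` under `X ↦ X̃`. -/
def subr {m : ℕ} (F : Subgroup (GLn m)) (𝔪 : Submodule ℝ (Mat m)) (Hr B : Mat m) : Mat m :=
  tilde F 𝔪 Hr ⁅Hr, compX B⁆

end CHyp

end

/-!
# The homogeneous structure tensors of complex hyperbolic space

In the affine chart, every element of `𝔤` has the shape `pMat U θ a b v` with `U` skew-hermitian,
and generates the affine vector field `(w, u) ↦ (U w + (a - iθ) w + v, -v* w + 2 a u + i b)`
(`fundField_pMat`).  Its value at `o` is `(v, -2 a + i b)`.  Hence the kernel of `B ↦ B*_o` on `𝔤`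
consists of the block diagonal elements with `a = 0`, and it equals `𝔥` (`mem_lieAlg_groupH`): here the
closedness of `F` enters, through the fact that the exponential of a velocity of a closed group
lies in the group.  Since `A₀ + Hr` and `𝔫` lie in `𝔤`, the map is onto `T_o`, so that it restricts
to a bijection on `𝔪`, and identities in `𝔪` can be checked at `o`.

For the formula, the structure tensor is evaluated on generators.  As `[B, C]` and `[B, C]_𝔪` differ
by an element of `𝔥`, the canonical connection satisfies `∇̃_{B*} C* = -[B, C]* = [B*, C*]` at `o`;
as `∇` is torsion-free, `S_B C = ∇_{C*} B*` (`structureTensor_ev`).  Koszul's formula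
(`IsLeviCivita.koszul`) then only requires the derivative of the metric at `o`
(`fderiv_metric_basePt`) and the brackets of affine vector fields.  In the outcome
(`metric_nabla_fundField`) the block diagonal part of `B` appears only through its action on `X_C`.
That part is `B' + α_B Hr` (`primeOf_add`), which produces the last two terms of the formula
(`gm_lie_primeOf_add_gm_subr`).
-/

namespace CHyp

open scoped Topology
open Filter

variable {m : ℕ} {μ : ℝ}

/-! ### Generators of one-parameter groups in the affine chart -/

section MatrixExp

attribute [local instance] Matrix.linftyOpNormedRing Matrix.linftyOpNormedAlgebra

lemma hasDerivAt_of_entries {m : ℕ} {f : ℝ → Mat m} {X : Mat m} {t : ℝ}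
    (h : ∀ i j, HasDerivAt (fun s => f s i j) (X i j) t) : HasDerivAt f X t :=
  hasDerivAt_pi.2 fun i => hasDerivAt_pi.2 fun j => h i j

lemma hasDerivAt_entry {m : ℕ} {f : ℝ → Mat m} {X : Mat m} {t : ℝ}
    (h : HasDerivAt f X t) (i j) : HasDerivAt (fun s => f s i j) (X i j) t :=
  hasDerivAt_pi.1 (hasDerivAt_pi.1 h i) j

lemma hasDerivAt_exp_smul_entry {m : ℕ} (B : Mat m) (i j) :
    HasDerivAt (fun t : ℝ => NormedSpace.exp (t • B) i j) (B i j) 0 := by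
  have h := hasDerivAt_exp_smul_const (𝕂 := ℝ) B (0 : ℝ)
  rw [zero_smul, NormedSpace.exp_zero, one_mul] at h
  exact hasDerivAt_entry h i j

end MatrixExp

/-- The generator of `B` in the affine chart, as a quadratic vector field. -/
lemma fundField_eq {m : ℕ} (B : Mat m) (p : Chart m) :
    fundField B p =
      (fun i => (B *ᵥ homog p) (Sum.inl i) - p.1 i * (B *ᵥ homog p) last₁,
        (B *ᵥ homog p) last₀ - p.2 * (B *ᵥ homog p) last₁) := by
  have hv : ∀ k, HasDerivAt (fun t : ℝ => (NormedSpace.exp (t • B) *ᵥ homog p) k)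
      ((B *ᵥ homog p) k) 0 := fun k => by
    simpa only [Matrix.mulVec, dotProduct] using HasDerivAt.fun_sum (u := Finset.univ)
      fun j _ => (hasDerivAt_exp_smul_entry B k j).mul_const (homog p j)
  have h1 : (NormedSpace.exp ((0 : ℝ) • B) *ᵥ homog p) last₁ = 1 := by
    simp [homog]
  have hq : ∀ k, HasDerivAt (fun t : ℝ => (NormedSpace.exp (t • B) *ᵥ homog p) k /
      (NormedSpace.exp (t • B) *ᵥ homog p) last₁)
      ((B *ᵥ homog p) k - homog p k * (B *ᵥ homog p) last₁) 0 := fun k => by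
    have := (hv k).fun_div (hv last₁) (by rw [h1]; exact one_ne_zero)
    rw [h1] at this
    refine this.congr_deriv ?_
    simp
  exact ((hasDerivAt_pi.2 fun i => hq (Sum.inl i)).prodMk (hq last₀)).deriv

/-! ### The group `F N`: shape of its elements -/

/-- The matrix of the hermitian form `herm`. -/
def formMat (m : ℕ) : Mat m := Matrix.fromBlocks 1 0 0 !![0, 1; 1, 0]

/-- The matrix with rows `(U, 0, v)`, `(-v*, a + iθ, ib)`, `(0, 0, -a + iθ)`.  For skew-hermitian
`U` these are the elements of `𝔲(n-1) + 𝔲(1) + ℝ A₀ + 𝔫`; no condition is put on the trace. -/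
def pMat (U : Matrix (Fin m) (Fin m) ℂ) (θ a b : ℝ) (v : Fin m → ℂ) : Mat m :=
  Matrix.fromBlocks U (Matrix.of fun i => ![0, v i])
    (Matrix.of ![fun j => -conj (v j), fun _ => 0])
    !![a + θ * Complex.I, b * Complex.I; 0, -a + θ * Complex.I]

lemma sMat_eq_pMat (a b : ℝ) (v : Fin m → ℂ) : sMat a b v = pMat 0 0 a b v := by
  simp [sMat, pMat]

/-- `A` is block upper triangular in the order `n`, `(1, …, n - 1)`, `n + 1` of the coordinates,
that is, it preserves the flag `⟨eₙ⟩ ⊆ ⟨e₁, …, eₙ⟩`. -/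
structure IsTri (A : Mat m) : Prop where
  inl_last₀ : ∀ i, A (Sum.inl i) last₀ = 0
  last₁_inl : ∀ i, A last₁ (Sum.inl i) = 0
  last₁_last₀ : A last₁ last₀ = 0

/-- The block diagonal part of a matrix, for the blocks of size `n - 1`, `1`, `1`; on block upper
triangular matrices it is multiplicative. -/
def diagPart (A : Mat m) : Mat m :=
  Matrix.fromBlocks A.toBlocks₁₁ 0 0 !![A last₀ last₀, 0; 0, A last₁ last₁]

lemma IsTri.mul {A B : Mat m} (hA : IsTri A) (hB : IsTri B) : IsTri (A * B) where
  inl_last₀ i := by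
    simp [Matrix.mul_apply, hA.inl_last₀, hB.inl_last₀, hB.last₁_last₀]
  last₁_inl i := by
    simp [Matrix.mul_apply, hA.last₁_inl, hB.last₁_inl, hA.last₁_last₀]
  last₁_last₀ := by
    simp [Matrix.mul_apply, hA.last₁_inl, hB.last₁_last₀, hA.last₁_last₀]

lemma diagPart_mul {A B : Mat m} (hA : IsTri A) (hB : IsTri B) :
    diagPart (A * B) = diagPart A * diagPart B := by
  simp only [diagPart, Matrix.fromBlocks_multiply]
  congr 1
  · ext i j
    simp [Matrix.mul_apply, Matrix.toBlocks₁₁, hA.inl_last₀, hB.last₁_inl]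
  · simp
  · simp
  · ext i j
    fin_cases i <;> fin_cases j <;>
      simp [Matrix.mul_apply, hB.inl_last₀, hA.last₁_inl, hB.last₁_last₀, hA.last₁_last₀]

lemma diagPart_one : diagPart (1 : Mat m) = 1 := by
  rw [diagPart, ← Matrix.fromBlocks_one]
  congr 1
  ext i j
  fin_cases i <;> fin_cases j <;> simp

lemma isTri_one : IsTri (1 : Mat m) := ⟨by simp, by simp, by simp⟩

/-- The block upper triangular matrices that preserve the hermitian form and have their block
diagonal part in `F`.  This group contains `F N`, and is described by conditions on the
entries, so that its Lie algebra can be read off.  Triangularity of the inverse is made part of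
the definition, since it is known for the generators of `F N`. -/
def envelope (F : Subgroup (GLn m)) : Subgroup (GLn m) where
  carrier := {g | IsTri (g : Mat m) ∧ IsTri ((g⁻¹ : GLn m) : Mat m) ∧
    (g : Mat m)ᴴ * formMat m * g = formMat m ∧ ∃ f ∈ F, diagPart (g : Mat m) = f}
  one_mem' := ⟨by simpa using isTri_one, by simpa using isTri_one, by simp,
    1, F.one_mem, by simpa using diagPart_one⟩
  mul_mem' := by
    rintro g h ⟨hg, hg', hgK, f, hf, hgf⟩ ⟨hh, hh', hhK, e, he, hhe⟩
    refine ⟨hg.mul hh, by simpa using hh'.mul hg', ?_, f * e, F.mul_mem hf he, ?_⟩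
    · calc ((g * h : GLn m) : Mat m)ᴴ * formMat m * ((g * h : GLn m) : Mat m)
          = (h : Mat m)ᴴ * ((g : Mat m)ᴴ * formMat m * g) * h := by
            simp only [Units.val_mul, Matrix.conjTranspose_mul, mul_assoc]
        _ = formMat m := by rw [hgK, hhK]
    · rw [Units.val_mul, diagPart_mul hg hh, hgf, hhe, Units.val_mul]
  inv_mem' := by
    rintro g ⟨hg, hg', hgK, f, hf, hgf⟩
    refine ⟨hg', by simpa using hg, ?_, f⁻¹, F.inv_mem hf, ?_⟩
    · have h1 : (g : Mat m) * ((g⁻¹ : GLn m) : Mat m) = 1 := g.mul_inv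
      have h2 : ((g⁻¹ : GLn m) : Mat m)ᴴ * (g : Mat m)ᴴ = 1 := by
        rw [← Matrix.conjTranspose_mul, h1, Matrix.conjTranspose_one]
      calc ((g⁻¹ : GLn m) : Mat m)ᴴ * formMat m * ((g⁻¹ : GLn m) : Mat m)
          = ((g⁻¹ : GLn m) : Mat m)ᴴ * ((g : Mat m)ᴴ * formMat m * g) *
              ((g⁻¹ : GLn m) : Mat m) := by rw [hgK]
        _ = (((g⁻¹ : GLn m) : Mat m)ᴴ * (g : Mat m)ᴴ) * formMat m *
              ((g : Mat m) * ((g⁻¹ : GLn m) : Mat m)) := by simp only [mul_assoc]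
        _ = formMat m := by rw [h1, h2, one_mul, mul_one]
    · have h1 : (f : Mat m) * diagPart ((g⁻¹ : GLn m) : Mat m) = 1 := by
        rw [← hgf, ← diagPart_mul hg hg', g.mul_inv, diagPart_one]
      exact (Units.inv_eq_of_mul_eq_one_right h1).symm

lemma isTri_maMat (U : Matrix (Fin m) (Fin m) ℂ) (ζ : ℂ) (t : ℝ) : IsTri (maMat U ζ t) :=
  ⟨by simp [maMat], by simp [maMat], by simp [maMat]⟩

lemma maMat_preserves_form {U : Matrix (Fin m) (Fin m) ℂ} (hU : U ∈ Matrix.unitaryGroup (Fin m) ℂ)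
    {ζ : ℂ} (hζ : ‖ζ‖ = 1) (t : ℝ) :
    (maMat U ζ t)ᴴ * formMat m * maMat U ζ t = formMat m := by
  have hUU : Uᴴ * U = 1 := (Matrix.mem_unitaryGroup_iff').1 hU
  have hz : conj ζ * ζ = 1 := by
    rw [← Complex.normSq_eq_conj_mul_self, Complex.normSq_eq_norm_sq, hζ]; simp
  have he : Complex.exp t * Complex.exp (-t) = 1 := by rw [← Complex.exp_add]; simp
  have he' : conj (Complex.exp t) = Complex.exp t := by rw [← Complex.exp_conj]; simp
  have he'' : conj (Complex.exp (-t)) = Complex.exp (-t) := by rw [← Complex.exp_conj]; simp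
  simp only [maMat, formMat, Matrix.fromBlocks_conjTranspose, Matrix.fromBlocks_multiply]
  congr 1
  · simp [hUU]
  · simp
  · simp
  · ext i j
    fin_cases i <;> fin_cases j <;> simp [Matrix.mul_apply, he', he'']
    · linear_combination hz * Complex.exp t * Complex.exp (-t) + he
    · linear_combination hz * Complex.exp t * Complex.exp (-t) + he

lemma diagPart_maMat (U : Matrix (Fin m) (Fin m) ℂ) (ζ : ℂ) (t : ℝ) :
    diagPart (maMat U ζ t) = maMat U ζ t := by
  simp [diagPart, maMat]

lemma le_envelope {F : Subgroup (GLn m)} (hF : F ≤ groupMA m) : F ≤ envelope F := by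
  intro g hg
  obtain ⟨U, hU, ζ, t, hζ, -, h⟩ := hF hg
  obtain ⟨V, -, ξ, s, -, -, h'⟩ := hF (F.inv_mem hg)
  refine ⟨h ▸ isTri_maMat U ζ t, h' ▸ isTri_maMat V ξ s, ?_, g, hg, ?_⟩
  · rw [h]; exact maMat_preserves_form hU hζ t
  · rw [h]; exact diagPart_maMat U ζ t

section
attribute [local instance] Matrix.linftyOpNormedRing Matrix.linftyOpNormedAlgebra

lemma exp_sMat (b : ℝ) (v : Fin m → ℂ) :
    NormedSpace.exp (sMat 0 b v) =
      1 + sMat 0 b v + (2 : ℝ)⁻¹ • (sMat 0 b v * sMat 0 b v) := by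
  have h3 : sMat 0 b v ^ 3 = 0 := by
    -- `sMat 0 b v` is strictly block triangular with three diagonal blocks
    rw [pow_succ, pow_two]
    ext i j
    rcases i with i | i <;> rcases j with j | j <;>
      [skip; fin_cases j; fin_cases i; (fin_cases i <;> fin_cases j)] <;>
      simp [sMat, Matrix.mul_apply]
  have h := NormedSpace.exp_series_hasSum_exp' (𝕂 := ℝ) (sMat 0 b v)
  have h' : HasSum (fun n : ℕ => ((n.factorial : ℝ))⁻¹ • sMat 0 b v ^ n)
      (∑ n ∈ Finset.range 3, ((n.factorial : ℝ))⁻¹ • sMat 0 b v ^ n) := by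
    refine hasSum_sum_of_ne_finset_zero fun n hn => ?_
    rw [Finset.mem_range, not_lt] at hn
    rw [← Nat.sub_add_cancel hn, pow_add, h3, mul_zero, smul_zero]
  refine (h.unique h').trans ?_
  simp [Finset.sum_range_succ, pow_two]

end

lemma isTri_exp_sMat (b : ℝ) (v : Fin m → ℂ) : IsTri (NormedSpace.exp (sMat 0 b v)) := by
  rw [exp_sMat]
  refine ⟨fun i => ?_, fun i => ?_, ?_⟩ <;> simp [sMat, Matrix.mul_apply]

lemma diagPart_exp_sMat (b : ℝ) (v : Fin m → ℂ) :
    diagPart (NormedSpace.exp (sMat 0 b v)) = 1 := by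
  rw [exp_sMat, diagPart, ← Matrix.fromBlocks_one]
  congr 1
  · ext i j; simp [sMat, Matrix.toBlocks₁₁, Matrix.mul_apply, Matrix.one_apply]
  · ext i j
    fin_cases i <;> fin_cases j <;> simp [sMat, Matrix.mul_apply]

lemma formMat_mul_self : formMat m * formMat m = 1 := by
  rw [formMat, Matrix.fromBlocks_multiply, ← Matrix.fromBlocks_one]
  congr 1
  · simp
  · simp
  · simp
  · ext i j
    fin_cases i <;> fin_cases j <;> simp

lemma exp_preserves_form {X : Mat m} (hX : Xᴴ * formMat m + formMat m * X = 0) :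
    (NormedSpace.exp X)ᴴ * formMat m * NormedSpace.exp X = formMat m := by
  have hK := formMat_mul_self (m := m)
  have hinv : (formMat m)⁻¹ = formMat m := Matrix.inv_eq_right_inv hK
  have hu : IsUnit (formMat m) := IsUnit.of_mul_eq_one _ hK
  -- the condition says that `X*` is conjugate to `-X` by the matrix of the form
  have h1 : Xᴴ = formMat m * (-X) * (formMat m)⁻¹ := by
    rw [hinv, mul_neg, ← eq_neg_of_add_eq_zero_left hX, mul_assoc, hK, mul_one]
  rw [← Matrix.exp_conjTranspose, h1, Matrix.exp_conj _ _ hu, hinv]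
  simp only [mul_assoc]
  rw [← mul_assoc (formMat m) (formMat m), hK, one_mul,
    ← Matrix.exp_add_of_commute _ _ (Commute.neg_left (Commute.refl X)), neg_add_cancel,
    NormedSpace.exp_zero, mul_one]

lemma sMat_form (b : ℝ) (v : Fin m → ℂ) :
    (sMat 0 b v)ᴴ * formMat m + formMat m * sMat 0 b v = 0 := by
  simp only [sMat, formMat, Matrix.fromBlocks_conjTranspose, Matrix.fromBlocks_multiply,
    Matrix.fromBlocks_add, ← Matrix.fromBlocks_zero]
  congr 1
  · simp
  · ext i j; fin_cases j <;> simp [Matrix.mul_apply]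
  · ext i j; fin_cases i <;> simp
  · ext i j; fin_cases i <;> fin_cases j <;> simp [Matrix.mul_apply]

lemma groupN_le_envelope (F : Subgroup (GLn m)) : groupN m ≤ envelope F := by
  rw [groupN, Subgroup.closure_le]
  rintro g ⟨b, v, hg⟩
  have hneg : -sMat 0 b v = sMat 0 (-b) (-v) := by
    simp only [sMat, Matrix.fromBlocks_neg]
    congr 1
    · simp
    · ext i j; fin_cases j <;> simp
    · ext i j; fin_cases i <;> simp
    · ext i j; fin_cases i <;> fin_cases j <;> simp
  have hg' : ((g⁻¹ : GLn m) : Mat m) = NormedSpace.exp (sMat 0 (-b) (-v)) := by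
    refine Units.inv_eq_of_mul_eq_one_right ?_
    rw [hg, ← hneg, ← Matrix.exp_add_of_commute _ _ (Commute.neg_right (Commute.refl (sMat 0 b v))),
      add_neg_cancel, NormedSpace.exp_zero]
  refine ⟨hg ▸ isTri_exp_sMat b v, hg' ▸ isTri_exp_sMat (-b) (-v), ?_, 1, F.one_mem, ?_⟩
  · rw [hg]; exact exp_preserves_form (sMat_form b v)
  · rw [hg]; exact diagPart_exp_sMat b v

lemma groupG_le_envelope {F : Subgroup (GLn m)} (hF : F ≤ groupMA m) :
    groupG F ≤ envelope F := sup_le (le_envelope hF) (groupN_le_envelope F)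

/-! ### Lie algebras of matrix groups -/

section NormedAlgebra

variable {𝔸 : Type*} [NormedRing 𝔸] [NormedAlgebra ℝ 𝔸] [CompleteSpace 𝔸]

lemma hasDerivAt_units_inv {γ : ℝ → 𝔸ˣ} {X : 𝔸} (h0 : γ 0 = 1)
    (h1 : HasDerivAt (fun t => (γ t : 𝔸)) X 0) :
    HasDerivAt (fun t => ((γ t)⁻¹ : 𝔸ˣ).1) (-X) 0 := by
  have h3 := hasFDerivAt_ringInverse (𝕜 := ℝ) (γ 0)
  have h4 := h3.comp_hasDerivAt (0 : ℝ) h1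
  simpa [Function.comp_def, Ring.inverse_unit, h0] using h4

/-- The exponential of the velocity at the identity of a curve in a closed subgroup lies in the
subgroup: it is the limit of `γ (1 / n) ^ n`, as `exp` is invertible near `0`. -/
lemma exp_mem_of_isClosed {K : Subgroup 𝔸ˣ} (hK : IsClosed (K : Set 𝔸ˣ)) {γ : ℝ → 𝔸ˣ} {X : 𝔸}
    (hγ : ∀ t, γ t ∈ K) (h0 : γ 0 = 1) (h1 : HasDerivAt (fun t => (γ t : 𝔸)) X 0) :
    ∃ g ∈ K, (g : 𝔸) = NormedSpace.exp X := by
  have he : HasStrictFDerivAt (NormedSpace.exp : 𝔸 → 𝔸)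
      ((ContinuousLinearEquiv.refl ℝ 𝔸 : 𝔸 ≃L[ℝ] 𝔸) : 𝔸 →L[ℝ] 𝔸) 0 :=
    hasStrictFDerivAt_exp_zero
  set L := he.localInverse with hL
  have hL1 : HasFDerivAt L (ContinuousLinearMap.id ℝ 𝔸) (γ 0 : 𝔸) := by
    have := he.to_localInverse.hasFDerivAt
    rw [NormedSpace.exp_zero] at this
    rw [h0]; exact this
  have hL0 : L 1 = 0 := by
    have := he.localInverse_apply_image
    rwa [NormedSpace.exp_zero] at this
  have h2 : HasDerivAt (fun t => L (γ t)) X 0 :=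
    HasFDerivAt.comp_hasDerivAt (l := L) (f := fun t => (γ t : 𝔸)) (0 : ℝ) hL1 h1
  have h3 : ∀ᶠ t in 𝓝 (0 : ℝ), NormedSpace.exp (L (γ t)) = (γ t : 𝔸) := by
    have := he.eventually_right_inverse
    rw [NormedSpace.exp_zero] at this
    have hc : Tendsto (fun t => (γ t : 𝔸)) (𝓝 0) (𝓝 1) := by
      have := h1.continuousAt.tendsto
      rwa [h0] at this
    exact hc.eventually this
  have hn : Tendsto (fun n : ℕ => ((n : ℝ) + 1)⁻¹) atTop (𝓝[≠] 0) := by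
    refine tendsto_nhdsWithin_iff.2 ⟨?_, Eventually.of_forall fun n => ?_⟩
    · simpa using tendsto_one_div_add_atTop_nhds_zero_nat (𝕜 := ℝ)
    · exact inv_ne_zero (by positivity)
  have h4 : Tendsto (fun n : ℕ => (n + 1) • L (γ ((n : ℝ) + 1)⁻¹)) atTop (𝓝 X) := by
    have := h2.tendsto_slope_zero.comp hn
    refine this.congr fun n => ?_
    simp only [Function.comp_apply, inv_inv, zero_add, h0, Units.val_one, hL0, sub_zero]
    rw [← Nat.cast_smul_eq_nsmul ℝ]
    push_cast
    rfl
  let _ : NormedAlgebra ℚ 𝔸 := NormedAlgebra.restrictScalars ℚ ℝ 𝔸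
  have h5 : Tendsto (fun n : ℕ => ((γ ((n : ℝ) + 1)⁻¹ ^ (n + 1) : 𝔸ˣ) : 𝔸)) atTop
      (𝓝 (NormedSpace.exp X)) := by
    refine ((NormedSpace.exp_continuous.tendsto X).comp h4).congr' ?_
    filter_upwards [(hn.mono_right nhdsWithin_le_nhds).eventually h3] with n hn'
    rw [Function.comp_apply, NormedSpace.exp_nsmul, hn', Units.val_pow_eq_pow_val]
  obtain ⟨g, hg⟩ : IsUnit (NormedSpace.exp X) := NormedSpace.isUnit_exp X
  have h6 : Tendsto (fun n : ℕ => γ ((n : ℝ) + 1)⁻¹ ^ (n + 1)) atTop (𝓝 g) := by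
    refine (Units.isOpenEmbedding_val (R := 𝔸)).isEmbedding.tendsto_nhds_iff.2 ?_
    rw [hg]; exact h5
  exact ⟨g, hK.mem_of_tendsto h6 (Eventually.of_forall fun n => K.pow_mem (hγ _) _), hg⟩

end NormedAlgebra

lemma lieAlg_mono {K L : Subgroup (GLn m)} (h : K ≤ L) : lieAlg K ≤ lieAlg L := by
  rintro X ⟨γ, hγ, h0, hX⟩
  exact ⟨γ, fun t => h (hγ t), h0, hX⟩

lemma lieAlg_entry_eq_zero {K : Subgroup (GLn m)} {X : Mat m} (hX : X ∈ lieAlg K) {i j}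
    (h : ∀ g ∈ K, (g : Mat m) i j = 0) : X i j = 0 := by
  obtain ⟨γ, hγ, -, hd⟩ := hX
  refine (hd i j).unique ?_
  simp only [h _ (hγ _)]
  exact hasDerivAt_const _ _

lemma lieAlg_entry_eq {K : Subgroup (GLn m)} {X : Mat m} (hX : X ∈ lieAlg K) {i j k l}
    (h : ∀ g ∈ K, (g : Mat m) i j = (g : Mat m) k l) : X i j = X k l := by
  obtain ⟨γ, hγ, -, hd⟩ := hX
  refine (hd i j).unique ?_
  simp only [h _ (hγ _)]
  exact hd k l

section
attribute [local instance] Matrix.linftyOpNormedRing Matrix.linftyOpNormedAlgebra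

lemma lieAlg_form {K : Subgroup (GLn m)}
    (hK : ∀ g ∈ K, (g : Mat m)ᴴ * formMat m * g = formMat m) {X : Mat m} (hX : X ∈ lieAlg K) :
    Xᴴ * formMat m + formMat m * X = 0 := by
  obtain ⟨γ, hγ, h0, hd⟩ := hX
  have h1 : HasDerivAt (fun t => (γ t : Mat m)) X 0 := hasDerivAt_of_entries hd
  have h2 : HasDerivAt (fun t => (γ t : Mat m)ᴴ) Xᴴ 0 :=
    hasDerivAt_of_entries fun i j => (hd j i).star
  have h3 := (h2.mul_const (formMat m)).fun_mul h1
  simp only [h0, hK _ (hγ _), Units.val_one, Matrix.conjTranspose_one, one_mul, mul_one] at h3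
  exact h3.unique (hasDerivAt_const _ _)

/-- The Lie algebra of a subgroup of matrices is closed under brackets. -/
lemma lieAlg_lie {K : Subgroup (GLn m)} {X Y : Mat m} (hX : X ∈ lieAlg K) (hY : Y ∈ lieAlg K) :
    ⁅X, Y⁆ ∈ lieAlg K := by
  obtain ⟨γ, hγ, h0, hd⟩ := hX
  have h1 : HasDerivAt (fun t => (γ t : Mat m)) X 0 := hasDerivAt_of_entries hd
  have h2 : HasDerivAt (fun t => ((γ t)⁻¹ : GLn m).1) (-X) 0 := by
    exact hasDerivAt_units_inv h0 h1
  have h5 := (h1.mul_const Y).fun_mul h2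
  simp only [h0, inv_one, Units.val_one, one_mul, mul_one] at h5
  -- the velocity of the curve `t ↦ Ad(γ t) Y` in the closed subspace `lieAlg K`
  have hAd : ∀ t, (γ t : Mat m) * Y * ((γ t)⁻¹ : GLn m).1 ∈ lieAlg K := by
    intro t
    obtain ⟨δ, hδ, k0, kd⟩ := hY
    refine ⟨fun s => γ t * δ s * (γ t)⁻¹,
      fun s => K.mul_mem (K.mul_mem (hγ t) (hδ s)) (K.inv_mem (hγ t)), by simp [k0], ?_⟩
    have k1 : HasDerivAt (fun t => (δ t : Mat m)) Y 0 := hasDerivAt_of_entries kd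
    exact fun i j => hasDerivAt_entry ((k1.const_mul (γ t : Mat m)).mul_const _) i j
  have hcl : IsClosed (lieAlg K : Set (Mat m)) := Submodule.closed_of_finiteDimensional _
  have hlim := h5.tendsto_slope_zero
  have hmem := hcl.mem_of_tendsto hlim (Eventually.of_forall fun t =>
    (lieAlg K).smul_mem _ ((lieAlg K).sub_mem (hAd _) (hAd _)))
  rw [Ring.lie_def]
  have : X * Y - Y * X = X * Y + Y * -X := by rw [mul_neg, sub_eq_add_neg]
  rw [this]; exact hmem

lemma exp_mem_of_mem_lieAlg {K : Subgroup (GLn m)} (hK : IsClosed (K : Set (GLn m))) {X : Mat m}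
    (hX : X ∈ lieAlg K) : ∃ g ∈ K, (g : Mat m) = NormedSpace.exp X := by
  obtain ⟨γ, hγ, h0, hd⟩ := hX
  exact exp_mem_of_isClosed hK hγ h0 (hasDerivAt_of_entries hd)

lemma exp_mulVec_of_eigenvector {X : Mat m} {v : Vec m} {x : ℂ} (h : X *ᵥ v = x • v) :
    NormedSpace.exp X *ᵥ v = Complex.exp x • v := by
  have hpow : ∀ n : ℕ, X ^ n *ᵥ v = x ^ n • v := by
    intro n
    induction n with
    | zero => simp
    | succ n ih => rw [pow_succ, ← Matrix.mulVec_mulVec, h, Matrix.mulVec_smul, ih, smul_smul,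
        pow_succ, mul_comm]
  have h1 := NormedSpace.exp_series_hasSum_exp' (𝕂 := ℂ) X
  have h2 := NormedSpace.exp_series_hasSum_exp' (𝕂 := ℂ) x
  let T : Mat m →ₗ[ℂ] Vec m :=
    { toFun := fun A => A *ᵥ v
      map_add' := fun A B => Matrix.add_mulVec A B v
      map_smul' := fun c A => Matrix.smul_mulVec c A v }
  have h3 := h1.map T (LinearMap.continuous_of_finiteDimensional T)
  have h4 := h2.smul_const v
  rw [Complex.exp_eq_exp_ℂ]
  refine h3.unique (h4.congr_fun fun n => ?_)
  simp [T, Matrix.smul_mulVec, hpow, smul_smul]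
end

/-! ### The reductive decomposition and the tangent space at the base point -/

lemma ev_eq (B : Mat m) :
    ev B = (fun i => B (Sum.inl i) last₁ - B (Sum.inl i) last₀,
      B last₀ last₁ - B last₀ last₀ + (B last₁ last₁ - B last₁ last₀)) := by
  have h : ∀ k, (B *ᵥ homog (basePt m)) k = B k last₁ - B k last₀ := fun k => by
    simp [Matrix.mulVec, dotProduct, homog, basePt]; ring
  rw [ev, fundField_eq]
  simp only [h]
  ext
  · simp [basePt]
  · simp [basePt]; ring

lemma ev_add (B C : Mat m) : ev (B + C) = ev B + ev C := by
  simp only [ev_eq]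
  ext <;> simp <;> ring

lemma ev_sub (B C : Mat m) : ev (B - C) = ev B - ev C := by
  simp only [ev_eq]
  ext <;> simp <;> ring

lemma ev_smul (c : ℝ) (B : Mat m) : ev (c • B) = c • ev B := by
  simp only [ev_eq]
  ext <;> simp <;> ring

lemma ev_pMat (U : Matrix (Fin m) (Fin m) ℂ) (θ a b : ℝ) (v : Fin m → ℂ) :
    ev (pMat U θ a b v) = (v, -2 * a + b * Complex.I) := by
  rw [ev_eq]
  ext
  · simp [pMat]
  · simp [pMat]; ring

/-- Differentiating the conditions that define the envelope gives the shape of its Lie algebra. -/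
lemma lieAlg_envelope {F : Subgroup (GLn m)} {X : Mat m} (hX : X ∈ lieAlg (envelope F)) :
    ∃ U θ a b v, Uᴴ = -U ∧ X = pMat U θ a b v := by
  have h0 : ∀ i, X (Sum.inl i) last₀ = 0 := fun i =>
    lieAlg_entry_eq_zero hX fun g (hg : g ∈ envelope F) => hg.1.inl_last₀ i
  have h1 : ∀ i, X last₁ (Sum.inl i) = 0 := fun i =>
    lieAlg_entry_eq_zero hX fun g (hg : g ∈ envelope F) => hg.1.last₁_inl i
  have h2 : X last₁ last₀ = 0 :=
    lieAlg_entry_eq_zero hX fun g (hg : g ∈ envelope F) => hg.1.last₁_last₀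
  have hK := lieAlg_form (fun g (hg : g ∈ envelope F) => hg.2.2.1) hX
  have e : ∀ i j, (Xᴴ * formMat m + formMat m * X) i j = 0 := fun i j => by rw [hK]; rfl
  have e1 : ∀ i j, conj (X (Sum.inl j) (Sum.inl i)) + X (Sum.inl i) (Sum.inl j) = 0 := fun i j => by
    simpa [formMat, Matrix.mul_apply, Matrix.one_apply] using e (Sum.inl i) (Sum.inl j)
  have e2 : conj (X last₀ last₀) + X last₁ last₁ = 0 := by
    simpa [formMat, Matrix.mul_apply] using e last₀ last₁
  have e3 : conj (X last₀ last₁) + X last₀ last₁ = 0 := by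
    simpa [formMat, Matrix.mul_apply] using e last₁ last₁
  have e4 : ∀ j, conj (X (Sum.inl j) last₁) + X last₀ (Sum.inl j) = 0 := fun j => by
    simpa [formMat, Matrix.mul_apply, Matrix.one_apply] using e last₁ (Sum.inl j)
  have e3' : (X last₀ last₁).re = 0 := by
    have := congrArg Complex.re e3; simp at this; linarith
  refine ⟨X.toBlocks₁₁, (X last₀ last₀).im, (X last₀ last₀).re, (X last₀ last₁).im,
    fun i => X (Sum.inl i) last₁, ?_, ?_⟩
  · ext i j
    exact eq_neg_of_add_eq_zero_left (e1 i j)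
  · ext i j
    rcases i with i | i <;> rcases j with j | j
    · rfl
    · fin_cases j
      · simpa [pMat] using h0 i
      · simp [pMat]
    · fin_cases i
      · simpa [pMat] using eq_neg_of_add_eq_zero_right (e4 j)
      · simpa [pMat] using h1 j
    · fin_cases i <;> fin_cases j
      · simp [pMat]
      · apply Complex.ext <;> simp [pMat]; exact e3'
      · simpa [pMat] using h2
      · have := eq_neg_of_add_eq_zero_right e2
        apply Complex.ext <;> simp [pMat] <;> simp [this]

lemma lieAlg_groupG {F : Subgroup (GLn m)} (hF : F ≤ groupMA m) {X : Mat m}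
    (hX : X ∈ lieAlg (groupG F)) : ∃ U θ a b v, Uᴴ = -U ∧ X = pMat U θ a b v :=
  lieAlg_envelope (lieAlg_mono (groupG_le_envelope hF) hX)

lemma groupM_le_groupMA : groupM m ≤ groupMA m := by
  rintro g ⟨U, hU, ζ, hζ, hd, hg⟩
  exact ⟨U, hU, ζ, 0, hζ, hd, hg⟩

lemma lieAlg_groupM {X : Mat m} (hX : X ∈ lieAlg (groupM m)) :
    ∃ U θ, Uᴴ = -U ∧ X = pMat U θ 0 0 0 := by
  obtain ⟨U, θ, a, b, v, hU, rfl⟩ :=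
    lieAlg_envelope (lieAlg_mono ((le_envelope le_rfl).trans' groupM_le_groupMA) hX)
  have hv : v = 0 := by
    ext i
    have := lieAlg_entry_eq_zero hX (i := Sum.inl i) (j := last₁) (by
      rintro g ⟨U, -, ζ, -, -, hg⟩; simp [hg, maMat])
    simpa [pMat] using this
  have hb : b = 0 := by
    have := lieAlg_entry_eq_zero hX (i := last₀) (j := last₁) (by
      rintro g ⟨U, -, ζ, -, -, hg⟩; simp [hg, maMat])
    simpa [pMat] using this
  have ha : a = 0 := by
    have := lieAlg_entry_eq hX (i := last₀) (j := last₀) (k := last₁) (l := last₁) (by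
      rintro g ⟨U, -, ζ, -, -, hg⟩; simp [hg, maMat])
    have := congrArg Complex.re this
    simp [pMat] at this
    linarith
  exact ⟨U, θ, hU, by rw [hv, ha, hb]⟩

lemma lieAlg_groupH {F : Subgroup (GLn m)} {X : Mat m} (hX : X ∈ lieAlg (groupH F)) :
    ∃ U θ, Uᴴ = -U ∧ X = pMat U θ 0 0 0 :=
  lieAlg_groupM (lieAlg_mono inf_le_right hX)

lemma ev_of_mem_lieAlg_groupH {F : Subgroup (GLn m)} {X : Mat m} (hX : X ∈ lieAlg (groupH F)) :
    ev X = 0 := by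
  obtain ⟨U, θ, -, rfl⟩ := lieAlg_groupH hX
  rw [ev_pMat]; ext <;> simp

/-- The block diagonal part of a curve in the envelope of `F` is a curve in `F`. -/
lemma diagPart_mem_lieAlg {F : Subgroup (GLn m)} {X : Mat m} (hX : X ∈ lieAlg (envelope F)) :
    diagPart X ∈ lieAlg F := by
  obtain ⟨γ, hγ, h0, hd⟩ := hX
  choose h1 h2 h3 f hf hγf using hγ
  refine ⟨f, hf, Units.ext ?_, fun i j => ?_⟩
  · rw [← hγf, h0, Units.val_one, diagPart_one]
  · simp only [← hγf]
    rcases i with i | i <;> rcases j with j | j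
    · exact hd _ _
    · exact hasDerivAt_const _ _
    · exact hasDerivAt_const _ _
    · fin_cases i <;> fin_cases j
      · exact hd _ _
      · exact hasDerivAt_const _ _
      · exact hasDerivAt_const _ _
      · exact hd _ _

/-- The kernel of `B ↦ B*_o` on `𝔤` is `𝔥`.  Such a `B` is block diagonal and, as the velocity of
the block diagonal part of a curve in `F N`, it lies in the Lie algebra of `F`; as `F` is closed,
`exp(tB)` lies in `F`, and its eigenvalue on `eₙ` has absolute value one, which kills the factor
in `ℝ`. -/
lemma mem_lieAlg_groupH {F : Subgroup (GLn m)} (hF : F ≤ groupMA m)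
    (hcl : IsClosed (F : Set (GLn m))) {X : Mat m} (hX : X ∈ lieAlg (groupG F))
    (h0 : ev X = 0) : X ∈ lieAlg (groupH F) := by
  have hX' := lieAlg_mono (groupG_le_envelope hF) hX
  have hdiag := diagPart_mem_lieAlg hX'
  obtain ⟨U, θ, a, b, v, hU, rfl⟩ := lieAlg_envelope hX'
  rw [ev_pMat, Prod.mk_eq_zero] at h0
  obtain ⟨rfl, hab⟩ := h0
  have ha : a = 0 := by simpa using congrArg Complex.re hab
  have hb : b = 0 := by simpa using congrArg Complex.im hab
  subst ha hb
  have hd : diagPart (pMat U θ 0 0 0) = pMat U θ 0 0 (0 : Fin m → ℂ) := by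
    simp only [diagPart, pMat]
    congr 1
    · ext i j; fin_cases j <;> simp
    · ext i j; fin_cases i <;> simp
    · ext i j; fin_cases i <;> fin_cases j <;> simp
  rw [hd] at hdiag
  have key : ∀ t : ℝ, ∃ g ∈ groupH F, (g : Mat m) = NormedSpace.exp (t • pMat U θ 0 0 0) := by
    intro t
    obtain ⟨g, hg, hge⟩ := exp_mem_of_mem_lieAlg hcl ((lieAlg F).smul_mem t hdiag)
    obtain ⟨V, hV, ζ, s, hζ, hdet, hgm⟩ := hF hg
    have h1 : (t • pMat U θ 0 0 0) *ᵥ (Pi.single last₀ 1 : Vec m) =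
        ((t * θ : ℝ) * Complex.I) • (Pi.single last₀ 1 : Vec m) := by
      ext k
      rcases k with k | k
      · simp [pMat]
      · fin_cases k <;> simp [pMat]; ring
    have h2 := congrFun (exp_mulVec_of_eigenvector h1) last₀
    rw [← hge, hgm] at h2
    have h3 := congrArg norm h2
    rw [Pi.smul_apply, smul_eq_mul, norm_mul, Complex.norm_exp_ofReal_mul_I] at h3
    have hs : s = 0 := by
      simpa [maMat, hζ, Complex.norm_exp] using h3
    exact ⟨g, ⟨hg, V, hV, ζ, hζ, hdet, by rw [hgm, hs]⟩, hge⟩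
  choose γ hγ he using key
  refine ⟨γ, hγ, Units.ext ?_, fun i j => ?_⟩
  · rw [he, zero_smul, NormedSpace.exp_zero, Units.val_one]
  · simp only [he]
    exact hasDerivAt_exp_smul_entry _ i j

lemma smul_sMat (t a b : ℝ) (v : Fin m → ℂ) : t • sMat a b v = sMat (t * a) (t * b) (t • v) := by
  simp only [sMat, Matrix.fromBlocks_smul]
  congr 1
  · simp
  · ext i j; fin_cases j <;> simp
  · ext i j; fin_cases i <;> simp
  · ext i j; fin_cases i <;> fin_cases j <;> simp
    ring

lemma sMat_mem_lieAlg_groupG (F : Subgroup (GLn m)) (b : ℝ) (v : Fin m → ℂ) :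
    sMat 0 b v ∈ lieAlg (groupG F) := by
  refine lieAlg_mono (le_sup_right : groupN m ≤ groupG F) ?_
  have key : ∀ t : ℝ, ∃ g ∈ groupN m, (g : Mat m) = NormedSpace.exp (t • sMat 0 b v) := by
    intro t
    obtain ⟨g, hg⟩ : IsUnit (NormedSpace.exp (t • sMat 0 b v)) := Matrix.isUnit_exp _
    refine ⟨g, Subgroup.subset_closure ⟨t * b, t • v, ?_⟩, hg⟩
    rw [hg, smul_sMat, mul_zero]
  choose γ hγ he using key
  refine ⟨γ, hγ, Units.ext ?_, fun i j => ?_⟩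
  · rw [he, zero_smul, NormedSpace.exp_zero, Units.val_one]
  · simp only [he]
    exact hasDerivAt_exp_smul_entry _ i j

section complement

variable {F : Subgroup (GLn m)} {𝔪 : Submodule ℝ (Mat m)} {Hr : Mat m}

lemma IsReductiveComplement.mem_lieAlg (h𝔪 : IsReductiveComplement F 𝔪) {B : Mat m} (hB : B ∈ 𝔪) :
    B ∈ lieAlg (groupG F) := h𝔪.sup_eq ▸ Submodule.mem_sup_right hB

/-- The map `B ↦ B*_o` is injective on `𝔪`, since its kernel on `𝔤` is `𝔥`. -/
lemma ev_injOn (hF : IsTransitiveFactor F) (h𝔪 : IsReductiveComplement F 𝔪) {B C : Mat m}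
    (hB : B ∈ 𝔪) (hC : C ∈ 𝔪) (h : ev B = ev C) : B = C := by
  have h1 : B - C ∈ lieAlg (groupH F) := mem_lieAlg_groupH hF.le hF.isClosed
    (h𝔪.mem_lieAlg (𝔪.sub_mem hB hC)) (by rw [ev_sub, h, sub_self])
  have h2 : B - C ∈ lieAlg (groupH F) ⊓ 𝔪 := ⟨h1, 𝔪.sub_mem hB hC⟩
  rw [h𝔪.inf_eq, Submodule.mem_bot] at h2
  exact sub_eq_zero.1 h2

lemma coefα_pMat (U : Matrix (Fin m) (Fin m) ℂ) (θ a b : ℝ) (v : Fin m → ℂ) :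
    coefα (pMat U θ a b v) = a := by simp [coefα, pMat]

lemma coefη_pMat (U : Matrix (Fin m) (Fin m) ℂ) (θ a b : ℝ) (v : Fin m → ℂ) :
    coefη (pMat U θ a b v) = b := by simp [coefη, pMat]

lemma compX_pMat (U : Matrix (Fin m) (Fin m) ℂ) (θ a b : ℝ) (v : Fin m → ℂ) :
    compX (pMat U θ a b v) = sMat 0 0 v := by simp [compX, pMat]

lemma sMat_add (a b a' b' : ℝ) (v v' : Fin m → ℂ) :
    sMat a b v + sMat a' b' v' = sMat (a + a') (b + b') (v + v') := by
  simp only [sMat, Matrix.fromBlocks_add]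
  congr 1
  · simp
  · ext i j; fin_cases j <;> simp
  · ext i j; fin_cases i <;> simp; ring
  · ext i j; fin_cases i <;> fin_cases j <;> simp <;> ring

/-- The defining property of `φ` and of `X ↦ X̃`: `χ_r X` lies in `𝔤 = 𝔥 + 𝔪`. -/
lemma phi_spec (h𝔪 : IsReductiveComplement F 𝔪) (hHr : IsHr F Hr) (a b : ℝ) (v : Fin m → ℂ) :
    phi F 𝔪 Hr (sMat a b v) ∈ lieAlg (groupH F) ∧ tilde F 𝔪 Hr (sMat a b v) ∈ 𝔪 := by
  have hchi : chi Hr (sMat a b v) ∈ lieAlg (groupG F) := by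
    have : chi Hr (sMat a b v) = sMat 0 b v + a • (A₀ m + Hr) := by
      have h : sMat a b v = sMat 0 b v + a • A₀ m := by
        rw [A₀, smul_sMat, sMat_add]; simp
      rw [chi, sMat_eq_pMat, coefα_pMat, ← sMat_eq_pMat, h, smul_add, add_assoc]
    rw [this]
    exact add_mem (sMat_mem_lieAlg_groupG F b v) (Submodule.smul_mem _ _
      (lieAlg_mono (le_sup_left : F ≤ groupG F) hHr.add_mem))
  rw [← h𝔪.sup_eq] at hchi
  obtain ⟨Y, hY, Z, hZ, hYZ⟩ := Submodule.mem_sup.1 hchi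
  exact Classical.epsilon_spec (p := fun U => U ∈ lieAlg (groupH F) ∧
    chi Hr (sMat a b v) + U ∈ 𝔪) ⟨-Y, neg_mem hY, by rw [← hYZ]; simpa using hZ⟩

lemma ev_chi (hHr : IsHr F Hr) (X : Mat m) : ev (chi Hr X) = ev X := by
  obtain ⟨U, θ, -, hH⟩ := lieAlg_groupM hHr.mem
  have : ev Hr = 0 := by rw [hH, ev_pMat]; ext <;> simp
  rw [chi, ev_add, ev_smul, this, smul_zero, add_zero]

lemma ev_tilde (h𝔪 : IsReductiveComplement F 𝔪) (hHr : IsHr F Hr) (a b : ℝ) (v : Fin m → ℂ) :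
    ev (tilde F 𝔪 Hr (sMat a b v)) = (v, -2 * a + b * Complex.I) := by
  rw [tilde, ev_add, ev_chi hHr, ev_of_mem_lieAlg_groupH (phi_spec h𝔪 hHr a b v).1, add_zero,
    sMat_eq_pMat, ev_pMat]

lemma exists_mem_ev_eq (h𝔪 : IsReductiveComplement F 𝔪) (hHr : IsHr F Hr) (x : Chart m) :
    ∃ B ∈ 𝔪, ev B = x := by
  refine ⟨_, (phi_spec h𝔪 hHr (-x.2.re / 2) x.2.im x.1).2, ?_⟩
  rw [ev_tilde h𝔪 hHr]
  refine Prod.ext rfl (Complex.ext ?_ ?_) <;> simp; ring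

lemma ev_bijective (hF : IsTransitiveFactor F) (h𝔪 : IsReductiveComplement F 𝔪)
    (hHr : IsHr F Hr) : Function.Bijective (fun B : 𝔪 => ev (B : Mat m)) := by
  refine ⟨fun B C h => Subtype.ext (ev_injOn hF h𝔪 B.2 C.2 h), fun x => ?_⟩
  obtain ⟨B, hB, h⟩ := exists_mem_ev_eq h𝔪 hHr x
  exact ⟨⟨B, hB⟩, h⟩

/-- The decomposition of an element of `𝔪`: both sides lie in `𝔪` and have the same value at
`o`. -/
lemma eq_sum_tilde (hF : IsTransitiveFactor F) (h𝔪 : IsReductiveComplement F 𝔪)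
    (hHr : IsHr F Hr) {B : Mat m} (hB : B ∈ 𝔪) :
    B = coefα B • tilde F 𝔪 Hr (A₀ m) + coefη B • tilde F 𝔪 Hr (N₂ m)
      + tilde F 𝔪 Hr (compX B) := by
  refine ev_injOn hF h𝔪 hB ?_ ?_
  · exact add_mem (add_mem (𝔪.smul_mem _ (phi_spec h𝔪 hHr _ _ _).2)
      (𝔪.smul_mem _ (phi_spec h𝔪 hHr _ _ _).2)) (phi_spec h𝔪 hHr _ _ _).2
  · obtain ⟨U, θ, a, b, v, -, rfl⟩ := lieAlg_groupG hF.le (h𝔪.mem_lieAlg hB)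
    rw [ev_add, ev_add, ev_smul, ev_smul, A₀, N₂, compX_pMat, ev_tilde h𝔪 hHr,
      ev_tilde h𝔪 hHr, ev_tilde h𝔪 hHr, coefα_pMat, coefη_pMat, ev_pMat]
    ext
    · simp
    · simp; ring

/-- The projection to `𝔪` does not change the value at `o` of the generator of `[B, C]`: as `𝔤` is
closed under brackets, `[B, C]` and `[B, C]_𝔪` differ by an element of `𝔥`. -/
lemma ev_projM_lie (h𝔪 : IsReductiveComplement F 𝔪) {B C : Mat m}
    (hB : B ∈ 𝔪) (hC : C ∈ 𝔪) : ev (projM F 𝔪 ⁅B, C⁆) = ev ⁅B, C⁆ := by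
  have h := lieAlg_lie (h𝔪.mem_lieAlg hB) (h𝔪.mem_lieAlg hC)
  rw [← h𝔪.sup_eq] at h
  obtain ⟨Y, hY, Z, hZ, hYZ⟩ := Submodule.mem_sup.1 h
  have hs := Classical.epsilon_spec (p := fun Z => Z ∈ 𝔪 ∧ ⁅B, C⁆ - Z ∈ lieAlg (groupH F))
    ⟨Z, hZ, by rw [← hYZ]; simpa using hY⟩
  have h2 := ev_of_mem_lieAlg_groupH hs.2
  rw [ev_sub, sub_eq_zero] at h2
  exact h2.symm

/-- The element `B' + α_B Hr` is the block diagonal skew-hermitian part of `B`. -/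
lemma primeOf_add (hF : IsTransitiveFactor F) (h𝔪 : IsReductiveComplement F 𝔪)
    (hHr : IsHr F Hr) {U : Matrix (Fin m) (Fin m) ℂ} {θ a b : ℝ} {v : Fin m → ℂ}
    (hB : pMat U θ a b v ∈ 𝔪) :
    primeOf F 𝔪 Hr (pMat U θ a b v) + a • Hr = pMat U θ 0 0 0 := by
  have h := eq_sum_tilde hF h𝔪 hHr hB
  have hp : pMat U θ a b v = pMat U θ 0 0 0 + sMat a b v := by
    simp only [pMat, sMat, Matrix.fromBlocks_add]
    congr 1
    · simp
    · ext i j; fin_cases j <;> simp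
    · ext i j; fin_cases i <;> simp
    · ext i j; fin_cases i <;> fin_cases j <;> simp <;> ring
  have hs : sMat a b v = a • A₀ m + b • N₂ m + compX (pMat U θ a b v) := by
    rw [compX_pMat, A₀, N₂, smul_sMat, smul_sMat, sMat_add, sMat_add]; simp
  have hN : coefα (N₂ m) = 0 := by simp [N₂, sMat_eq_pMat, coefα_pMat]
  have hA : coefα (A₀ m) = 1 := by simp [A₀, sMat_eq_pMat, coefα_pMat]
  have hX : coefα (compX (pMat U θ a b v)) = 0 := by
    simp [compX_pMat, sMat_eq_pMat, coefα_pMat]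
  have h' : pMat U θ 0 0 0 = pMat U θ a b v - sMat a b v := by rw [hp]; abel
  rw [h', hs]
  nth_rw 2 [h]
  simp only [primeOf, coefα_pMat, coefη_pMat, tilde, chi, hN, hA, hX, zero_smul, one_smul,
    add_zero, smul_add]
  abel

end complement

/-! ### The metric and its derivative at the base point -/

lemma herm_eq (X Y : Vec m) : herm X Y =
    star (fun i => Y (Sum.inl i)) ⬝ᵥ (fun i => X (Sum.inl i))
      + conj (Y last₁) * X last₀ + conj (Y last₀) * X last₁ := rfl

lemma herm_add_left (X X' Y : Vec m) : herm (X + X') Y = herm X Y + herm X' Y := by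
  simp only [herm, Pi.add_apply, mul_add, Finset.sum_add_distrib]; ring

lemma herm_smul_left (c : ℂ) (X Y : Vec m) : herm (c • X) Y = c * herm X Y := by
  have h : (fun i => (c • X) (Sum.inl i)) = c • fun i : Fin m => X (Sum.inl i) := rfl
  rw [herm_eq, herm_eq, h, dotProduct_smul]
  simp only [Pi.smul_apply, smul_eq_mul]
  ring

lemma herm_conj (X Y : Vec m) : conj (herm X Y) = herm Y X := by
  simp only [herm, map_add, map_sum, map_mul, Complex.conj_conj]
  rw [add_assoc, add_assoc, add_comm (Y last₁ * _)]
  simp only [mul_comm]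

lemma herm_add_right (X Y Y' : Vec m) : herm X (Y + Y') = herm X Y + herm X Y' := by
  rw [← herm_conj, herm_add_left, map_add, herm_conj, herm_conj]

lemma herm_smul_right (c : ℂ) (X Y : Vec m) : herm X (c • Y) = conj c * herm X Y := by
  rw [← herm_conj, herm_smul_left, map_mul, herm_conj]

/-- The defining function of the Siegel domain. -/
def rho (p : Chart m) : ℝ := -(herm (homog p) (homog p)).re

/-- The hermitian product with the homogeneous coordinates of `p` of a tangent vector at `p`. -/
def beta (p v : Chart m) : ℂ := star p.1 ⬝ᵥ v.1 + v.2

lemma rho_eq (p : Chart m) : rho p = -((star p.1 ⬝ᵥ p.1).re + 2 * p.2.re) := by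
  simp [rho, herm_eq, homog]
  ring

lemma rho_pos {p : Chart m} (hp : p ∈ siegel m) : 0 < rho p := neg_pos.2 hp

lemma herm_homog (p : Chart m) : herm (homog p) (homog p) = -(rho p : ℂ) := by
  have h := Complex.conj_eq_iff_real.1 (herm_conj (homog p) (homog p))
  obtain ⟨r, hr⟩ := h
  simp [rho, hr]

/-- The hermitian metric of `CH(n)` at a point of the Siegel domain. -/
lemma herm_horLift (hμ : 0 < μ) {p : Chart m} (hp : p ∈ siegel m) (v w : Chart m) :
    herm (horLift μ p v) (horLift μ p w) =
      (μ / rho p : ℝ) * (star w.1 ⬝ᵥ v.1 + beta p v * conj (beta p w) / rho p) := by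
  have hρ := rho_pos hp
  have hρ' : (rho p : ℂ) ≠ 0 := by exact_mod_cast hρ.ne'
  set c : ℝ := √(μ / rho p) with hc
  have hc0 : (c : ℂ) ≠ 0 := by
    exact_mod_cast (Real.sqrt_pos.2 (div_pos hμ hρ)).ne'
  have hcc : (c : ℂ) * c = (μ / rho p : ℝ) := by
    exact_mod_cast Real.mul_self_sqrt (div_pos hμ hρ).le
  have hlift : lift μ p = (c : ℂ) • homog p := by
    ext k; simp [lift, hc, rho]
  have hb : ∀ v : Chart m, herm (Sum.elim v.1 ![v.2, 0] : Vec m) (homog p) = beta p v := fun v => by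
    simp [herm_eq, homog, beta]
  have hb' : ∀ v : Chart m, herm (homog p) (Sum.elim v.1 ![v.2, 0] : Vec m) = conj (beta p v) :=
    fun v => by rw [← hb, herm_conj]
  have hvw : herm (Sum.elim v.1 ![v.2, 0] : Vec m) (Sum.elim w.1 ![w.2, 0]) = star w.1 ⬝ᵥ v.1 := by
    simp [herm_eq]
  have hor : ∀ v : Chart m, horLift μ p v =
      (c : ℂ) • ((Sum.elim v.1 ![v.2, 0] : Vec m) + (beta p v / rho p) • homog p) := fun v => by
    have h1 : lift μ p last₁ = c := by rw [hlift]; simp [homog]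
    simp only [horLift]
    rw [h1, hlift, herm_smul_left, herm_smul_left, herm_smul_right, herm_smul_right, hb,
      herm_homog, Complex.conj_ofReal, smul_add, smul_smul, smul_smul, sub_eq_add_neg, ← neg_smul]
    congr 2
    field_simp
  rw [hor, hor, herm_smul_left, herm_smul_right, herm_add_left, herm_add_right, herm_add_right,
    herm_smul_left, herm_smul_left, herm_smul_right, herm_smul_right, hvw, hb, hb', herm_homog,
    Complex.conj_ofReal, ← mul_assoc, hcc, map_div₀, Complex.conj_ofReal]
  field_simp
  ring

lemma basePt_mem : basePt m ∈ siegel m := by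
  simp [siegel, herm_eq, homog, basePt]

lemma rho_basePt : rho (basePt m) = 2 := by
  simp [rho_eq, basePt]

lemma herm_horLift_basePt (hμ : 0 < μ) (v w : Chart m) :
    herm (horLift μ (basePt m) v) (horLift μ (basePt m) w) =
      (μ / 2 : ℝ) * (star w.1 ⬝ᵥ v.1 + v.2 * conj w.2 / 2) := by
  rw [herm_horLift hμ basePt_mem, rho_basePt]
  simp [beta, basePt]

lemma metric_basePt (hμ : 0 < μ) (v w : Chart m) : metric μ (basePt m) v w =
    μ / 2 * (star w.1 ⬝ᵥ v.1 + v.2 * conj w.2 / 2).re := by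
  rw [metric, herm_horLift_basePt hμ, Complex.re_ofReal_mul]

lemma kaehlerForm_basePt (hμ : 0 < μ) (v w : Chart m) : kaehlerForm μ (basePt m) v w =
    μ / 2 * (star w.1 ⬝ᵥ v.1 + v.2 * conj w.2 / 2).im := by
  rw [kaehlerForm, herm_horLift_basePt hμ, Complex.im_ofReal_mul]

lemma isOpen_siegel : IsOpen (siegel m) := by
  have : siegel m = {p | 0 < rho p} := by ext p; simp [siegel, rho]
  rw [this]
  refine isOpen_lt continuous_const ?_
  rw [show (rho : Chart m → ℝ) = _ from funext rho_eq]
  simp only [dotProduct, Pi.star_apply]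
  fun_prop

lemma hasDerivAt_dotProduct_star {x y : ℝ → Fin m → ℂ} {x' y' : Fin m → ℂ} {t : ℝ}
    (hx : HasDerivAt x x' t) (hy : HasDerivAt y y' t) :
    HasDerivAt (fun s => star (x s) ⬝ᵥ y s) (star x' ⬝ᵥ y t + star (x t) ⬝ᵥ y') t := by
  have := HasDerivAt.fun_sum (u := Finset.univ) fun i _ =>
    ((hasDerivAt_pi.1 hx i).star).fun_mul (hasDerivAt_pi.1 hy i)
  rw [Finset.sum_add_distrib] at this
  exact this

/-- The derivative at `o` of the scalar product of two vector fields `Y`, `Z`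
with differentials `Y'`, `Z'`. -/
lemma fderiv_metric_basePt (hμ : 0 < μ) {Y Z : Chart m → Chart m}
    {Y' Z' : Chart m →L[ℝ] Chart m} (hY : HasFDerivAt Y Y' (basePt m))
    (hZ : HasFDerivAt Z Z' (basePt m)) (d : Chart m) :
    fderiv ℝ (fun q => metric μ q (Y q) (Z q)) (basePt m) d =
      μ / 2 * (d.2.re * (star (Z (basePt m)).1 ⬝ᵥ (Y (basePt m)).1
          + (Y (basePt m)).2 * conj (Z (basePt m)).2)
        + (star (Z (basePt m)).1 ⬝ᵥ (Y' d).1 + star (Z' d).1 ⬝ᵥ (Y (basePt m)).1)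
        + ((star d.1 ⬝ᵥ (Y (basePt m)).1 + (Y' d).2) * conj (Z (basePt m)).2
          + (Y (basePt m)).2 * conj (star d.1 ⬝ᵥ (Z (basePt m)).1 + (Z' d).2)) / 2).re := by
  set o := basePt m with ho
  set r : Chart m → ℂ := fun q => -(star q.1 ⬝ᵥ q.1 + (q.2 + star q.2)) with hr
  set f : Chart m → ℂ := fun q => μ / r q * (star (Z q).1 ⬝ᵥ (Y q).1 +
    (star q.1 ⬝ᵥ (Y q).1 + (Y q).2) * star (star q.1 ⬝ᵥ (Z q).1 + (Z q).2) / r q) with hf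
  have hr2 : r o = 2 := by simp [hr, ho, basePt]; norm_num
  have hev : (fun q => metric μ q (Y q) (Z q)) =ᶠ[𝓝 o] fun q => Complex.reCLM (f q) := by
    filter_upwards [isOpen_siegel.mem_nhds (basePt_mem (m := m))] with q hq
    have hrq : (rho q : ℂ) = r q := by
      rw [← neg_eq_iff_eq_neg.2 (herm_homog q)]
      simp [hr, herm_eq, homog]; ring
    rw [metric, herm_horLift hμ hq, Complex.ofReal_div, hrq]
    rfl
  rw [hev.fderiv_eq]
  have hdiff : DifferentiableAt ℝ f o := by
    have hYd := hY.differentiableAt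
    have hZd := hZ.differentiableAt
    have hrd : DifferentiableAt ℝ r o := by
      simp only [hr, dotProduct, Pi.star_apply]
      fun_prop
    have h2 : r o ≠ 0 := by rw [hr2]; norm_num
    have hdot : ∀ {x y : Chart m → Fin m → ℂ}, DifferentiableAt ℝ x o → DifferentiableAt ℝ y o →
        DifferentiableAt ℝ (fun q => star (x q) ⬝ᵥ y q) o := fun hx hy => by
      simp only [dotProduct, Pi.star_apply]
      fun_prop
    have hb : ∀ {W : Chart m → Chart m}, DifferentiableAt ℝ W o →
        DifferentiableAt ℝ (fun q => star q.1 ⬝ᵥ (W q).1 + (W q).2) o := fun hW =>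
      (hdot differentiableAt_fst hW.fst).fun_add hW.snd
    have hri : DifferentiableAt ℝ (fun q => (r q)⁻¹) o := hrd.fun_inv h2
    simp only [hf, div_eq_mul_inv]
    exact ((differentiableAt_const _).fun_mul hri).fun_mul
      ((hdot hZd.fst hYd.fst).fun_add (((hb hYd).fun_mul (hb hZd).star).fun_mul hri))
  -- the derivative along the line `t ↦ o + t d`
  have hline : HasDerivAt (fun t : ℝ => o + t • d) d 0 := by
    simpa using ((hasDerivAt_id (0 : ℝ)).smul_const d).const_add o
  have h0 : o + (0 : ℝ) • d = o := by simp
  have hYl : HasDerivAt (fun t : ℝ => Y (o + t • d)) (Y' d) 0 :=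
    HasFDerivAt.comp_hasDerivAt (f := fun t : ℝ => o + t • d) (0 : ℝ) (h0.symm ▸ hY) hline
  have hZl : HasDerivAt (fun t : ℝ => Z (o + t • d)) (Z' d) 0 :=
    HasFDerivAt.comp_hasDerivAt (f := fun t : ℝ => o + t • d) (0 : ℝ) (h0.symm ▸ hZ) hline
  have hfst : ∀ {x : ℝ → Chart m} {x' : Chart m}, HasDerivAt x x' 0 →
      HasDerivAt (fun t => (x t).1) x'.1 0 := fun h =>
    (ContinuousLinearMap.fst ℝ (Fin m → ℂ) ℂ).hasFDerivAt.comp_hasDerivAt (0 : ℝ) h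
  have hsnd : ∀ {x : ℝ → Chart m} {x' : Chart m}, HasDerivAt x x' 0 →
      HasDerivAt (fun t => (x t).2) x'.2 0 := fun h =>
    (ContinuousLinearMap.snd ℝ (Fin m → ℂ) ℂ).hasFDerivAt.comp_hasDerivAt (0 : ℝ) h
  have hrl : HasDerivAt (fun t : ℝ => r (o + t • d)) (-(2 * d.2.re : ℝ)) 0 := by
    have := ((hasDerivAt_dotProduct_star (hfst hline) (hfst hline)).fun_add
      ((hsnd hline).fun_add (hsnd hline).star)).fun_neg
    refine this.congr_deriv ?_
    have hc : d.2 + star d.2 = (2 * d.2.re : ℝ) := Complex.add_conj d.2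
    rw [hc, h0]
    simp [ho, basePt]
  have hbl : ∀ {W : Chart m → Chart m} {W' : Chart m →L[ℝ] Chart m},
      HasDerivAt (fun t : ℝ => W (o + t • d)) (W' d) 0 →
      HasDerivAt (fun t : ℝ => star (o + t • d).1 ⬝ᵥ (W (o + t • d)).1 + (W (o + t • d)).2)
        (star d.1 ⬝ᵥ (W o).1 + (W' d).2) 0 := fun {W W'} h => by
    have := (hasDerivAt_dotProduct_star (hfst hline) (hfst h)).fun_add (hsnd h)
    refine this.congr_deriv ?_
    rw [h0]
    simp [ho, basePt]
  have hfl := ((hasDerivAt_const (0 : ℝ) (μ : ℂ)).fun_div hrl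
    (by rw [h0, hr2]; norm_num)).fun_mul ((hasDerivAt_dotProduct_star (hfst hZl)
      (hfst hYl)).fun_add (((hbl hYl).fun_mul (hbl hZl).star).fun_div hrl
        (by rw [h0, hr2]; norm_num)))
  have hfl' : HasDerivAt (fun t : ℝ => f (o + t • d)) (fderiv ℝ f o d) 0 :=
    HasFDerivAt.comp_hasDerivAt (l := f) (f := fun t : ℝ => o + t • d) (0 : ℝ)
      (h0.symm ▸ hdiff.hasFDerivAt) hline
  have hcomp : fderiv ℝ (fun q => Complex.reCLM (f q)) o d = (fderiv ℝ f o d).re := by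
    have h := (Complex.reCLM.hasFDerivAt.comp o hdiff.hasFDerivAt).fderiv
    exact congrArg (fun T => T d) h
  rw [hcomp, hfl'.unique hfl, h0, hr2]
  have hb0 : ∀ v : Chart m, star o.1 ⬝ᵥ v.1 = 0 := fun v => by simp [ho, basePt]
  rw [hb0, hb0]
  refine Eq.trans ?_ (Complex.re_ofReal_mul _ _)
  congr 1
  simp only [starRingEnd_apply]
  push_cast
  ring_nf

/-! ### The Levi-Civita connection on generators -/

lemma metric_comm (v w : Chart m) :
    metric μ (basePt m) v w = metric μ (basePt m) w v := by
  rw [metric, metric, ← herm_conj, Complex.conj_re]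

lemma metric_sub_left (hμ : 0 < μ) (v v' w : Chart m) :
    metric μ (basePt m) (v - v') w = metric μ (basePt m) v w - metric μ (basePt m) v' w := by
  simp only [metric_basePt hμ, Prod.fst_sub, Prod.snd_sub, dotProduct_sub]
  simp
  ring

lemma metric_sub_right (hμ : 0 < μ) (v w w' : Chart m) :
    metric μ (basePt m) v (w - w') = metric μ (basePt m) v w - metric μ (basePt m) v w' := by
  rw [metric_comm, metric_sub_left hμ, metric_comm w, metric_comm w']

/-- Koszul's formula at the base point. -/
lemma IsLeviCivita.koszul {cov : Cov m} (h : IsLeviCivita μ cov) (hμ : 0 < μ)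
    {X Y Z : Chart m → Chart m} (hX : Differentiable ℝ X) (hY : Differentiable ℝ Y)
    (hZ : Differentiable ℝ Z) :
    2 * metric μ (basePt m) (cov Y (basePt m) (X (basePt m))) (Z (basePt m)) =
      fderiv ℝ (fun q => metric μ q (Y q) (Z q)) (basePt m) (X (basePt m))
      + fderiv ℝ (fun q => metric μ q (X q) (Z q)) (basePt m) (Y (basePt m))
      - fderiv ℝ (fun q => metric μ q (X q) (Y q)) (basePt m) (Z (basePt m))
      + metric μ (basePt m) (VectorField.lieBracket ℝ X Y (basePt m)) (Z (basePt m))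
      - metric μ (basePt m) (VectorField.lieBracket ℝ X Z (basePt m)) (Y (basePt m))
      - metric μ (basePt m) (VectorField.lieBracket ℝ Y Z (basePt m)) (X (basePt m)) := by
  have ho := basePt_mem (m := m)
  have t : ∀ {V W : Chart m → Chart m}, Differentiable ℝ V → Differentiable ℝ W → ∀ w,
      metric μ (basePt m) (VectorField.lieBracket ℝ V W (basePt m)) w =
        metric μ (basePt m) (cov W (basePt m) (V (basePt m))) w -
          metric μ (basePt m) (cov V (basePt m) (W (basePt m))) w := fun hV hW w =>
    (congrArg (metric μ (basePt m) · w)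
      (h.torsion_free _ _ _ ho hV.differentiableAt hW.differentiableAt).symm).trans
      (metric_sub_left hμ _ _ _)
  rw [h.compatible _ _ _ ho hY.differentiableAt hZ.differentiableAt,
    h.compatible _ _ _ ho hX.differentiableAt hZ.differentiableAt,
    h.compatible _ _ _ ho hX.differentiableAt hY.differentiableAt,
    t hX hY, t hX hZ, t hY hZ]
  have e1 := metric_comm (μ := μ) (Y (basePt m)) (cov Z (basePt m) (X (basePt m)))
  have e2 := metric_comm (μ := μ) (X (basePt m)) (cov Z (basePt m) (Y (basePt m)))
  have e3 := metric_comm (μ := μ) (X (basePt m)) (cov Y (basePt m) (Z (basePt m)))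
  linarith

/-- The linear part of the affine vector field generated by `pMat U θ a b v`. -/
noncomputable def linPart (U : Matrix (Fin m) (Fin m) ℂ) (θ a : ℝ) (v : Fin m → ℂ) :
    Chart m →L[ℝ] Chart m :=
  LinearMap.toContinuousLinearMap
    { toFun := fun p => (U *ᵥ p.1 + (a - θ * Complex.I) • p.1, -(star v ⬝ᵥ p.1) + 2 * a * p.2)
      map_add' := fun p q => by
        ext
        · simp [Matrix.mulVec_add]; ring
        · simp; ring
      map_smul' := fun c p => by
        ext
        · simp [Matrix.mulVec_smul]; ring
        · simp; ring }

lemma linPart_apply (U : Matrix (Fin m) (Fin m) ℂ) (θ a : ℝ) (v : Fin m → ℂ) (p : Chart m) :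
    linPart U θ a v p =
      (U *ᵥ p.1 + (a - θ * Complex.I) • p.1, -(star v ⬝ᵥ p.1) + 2 * a * p.2) := rfl

lemma fundField_pMat (U : Matrix (Fin m) (Fin m) ℂ) (θ a b : ℝ) (v : Fin m → ℂ) (p : Chart m) :
    fundField (pMat U θ a b v) p = linPart U θ a v p + (v, b * Complex.I) := by
  have h0 : ∀ i, (pMat U θ a b v *ᵥ homog p) (Sum.inl i) = (U *ᵥ p.1) i + v i := fun i => by
    simp [pMat, homog, Matrix.mulVec, dotProduct]
  have h1 : (pMat U θ a b v *ᵥ homog p) last₀ =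
      -(star v ⬝ᵥ p.1) + (a + θ * Complex.I) * p.2 + b * Complex.I := by
    simp [pMat, homog, Matrix.mulVec, dotProduct]; ring
  have h2 : (pMat U θ a b v *ᵥ homog p) last₁ = -a + θ * Complex.I := by
    simp [pMat, homog, Matrix.mulVec, dotProduct]
  rw [fundField_eq, linPart_apply]
  simp only [h0, h1, h2]
  ext
  · simp; ring
  · simp; ring

lemma hasFDerivAt_fundField (U : Matrix (Fin m) (Fin m) ℂ) (θ a b : ℝ) (v : Fin m → ℂ)
    (p : Chart m) : HasFDerivAt (fundField (pMat U θ a b v)) (linPart U θ a v) p := by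
  rw [show fundField (pMat U θ a b v) = _ from funext (fundField_pMat U θ a b v)]
  exact (linPart U θ a v).hasFDerivAt.add_const _

lemma fundField_basePt (U : Matrix (Fin m) (Fin m) ℂ) (θ a b : ℝ) (v : Fin m → ℂ) :
    fundField (pMat U θ a b v) (basePt m) = (v, -2 * a + b * Complex.I) := ev_pMat U θ a b v

/-- The bracket of fundamental fields is minus the fundamental field of the bracket. -/
lemma lieBracket_fundField_basePt (U U' : Matrix (Fin m) (Fin m) ℂ) (θ θ' a a' b b' : ℝ)
    (v v' : Fin m → ℂ) :
    VectorField.lieBracket ℝ (fundField (pMat U θ a b v)) (fundField (pMat U' θ' a' b' v'))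
      (basePt m) = -ev ⁅pMat U θ a b v, pMat U' θ' a' b' v'⁆ := by
  rw [VectorField.lieBracket, (hasFDerivAt_fundField _ _ _ _ _ _).fderiv,
    (hasFDerivAt_fundField _ _ _ _ _ _).fderiv, fundField_basePt, fundField_basePt, linPart_apply,
    linPart_apply, ev_eq, Ring.lie_def]
  ext
  · simp [pMat, Matrix.mul_apply, Matrix.mulVec, dotProduct]
    ring
  · simp [pMat, Matrix.mul_apply, dotProduct]
    ring

section structureTensor

variable {F : Subgroup (GLn m)} {𝔪 : Submodule ℝ (Mat m)}

/-- The structure tensor may be computed with any vector field that extends a tangent vector. -/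
lemma structureTensor_eq {cov cov' : Cov m} (h : IsConnection cov) (h' : IsConnection cov')
    {p v : Chart m} (hp : p ∈ siegel m) {Y : Chart m → Chart m} (hY : ContDiff ℝ 1 Y) :
    structureTensor h h' p v (Y p) = cov Y p v - cov' Y p v := by
  have hs := (contMDiff_vectorSpace_iff_contDiff (𝕜 := ℝ) (n := 1)
    (V := fun p : Chart m => (Y p : TangentSpace 𝓘(ℝ, Chart m) p))).2 hY
  have := IsCovariantDerivativeOn.difference_apply (I := 𝓘(ℝ, Chart m)) (F := Chart m)
    (V := fun p : Chart m => TangentSpace 𝓘(ℝ, Chart m) p) h h' hp (σ := Y)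
    (hs.mdifferentiable one_ne_zero p)
  exact congrArg (fun T => T v) this

lemma contDiff_fundField (U : Matrix (Fin m) (Fin m) ℂ) (θ a b : ℝ) (v : Fin m → ℂ) :
    ContDiff ℝ 1 (fundField (pMat U θ a b v)) := by
  rw [show fundField (pMat U θ a b v) = _ from funext (fundField_pMat U θ a b v)]
  exact (linPart U θ a v).contDiff.add contDiff_const

/-- `S_B C = ∇_{C*} B*`: the definition of the canonical connection gives
`∇̃_{B*} C* = -[B, C]* = [B*, C*]` at `o`, and `∇` is torsion-free. -/
lemma structureTensor_ev (hF : IsTransitiveFactor F) (h𝔪 : IsReductiveComplement F 𝔪)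
    {nabla nablaTilde : Cov m} (hLC : IsLeviCivita μ nabla)
    (hcan : IsCanonicalConnection F 𝔪 nablaTilde) {B C : Mat m} (hB : B ∈ 𝔪) (hC : C ∈ 𝔪) :
    structureTensor hLC.isConnection hcan.isConnection (basePt m) (ev B) (ev C) =
      nabla (fundField B) (basePt m) (ev C) := by
  have hcB := hcan.at_base B hB C hC
  have hp := ev_projM_lie h𝔪 hB hC
  obtain ⟨U, θ, a, b, v, -, rfl⟩ := lieAlg_groupG hF.le (h𝔪.mem_lieAlg hB)
  obtain ⟨U', θ', a', b', v', -, rfl⟩ := lieAlg_groupG hF.le (h𝔪.mem_lieAlg hC)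
  have h1 := structureTensor_eq hLC.isConnection hcan.isConnection (v := ev (pMat U θ a b v))
    basePt_mem (contDiff_fundField U' θ' a' b' v')
  have h2 := hLC.torsion_free _ _ _ (basePt_mem (m := m))
    (hasFDerivAt_fundField U θ a b v _).differentiableAt
    (hasFDerivAt_fundField U' θ' a' b' v' _).differentiableAt
  rw [lieBracket_fundField_basePt, ← hp] at h2
  refine h1.trans ?_
  have h3 : nablaTilde (fundField (pMat U' θ' a' b' v')) (basePt m) (ev (pMat U θ a b v)) =
    nabla (fundField (pMat U' θ' a' b' v')) (basePt m) (fundField (pMat U θ a b v) (basePt m)) -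
      nabla (fundField (pMat U θ a b v)) (basePt m)
        (fundField (pMat U' θ' a' b' v') (basePt m)) := hcB.trans h2.symm
  exact (congrArg₂ HSub.hSub rfl h3).trans (sub_sub_cancel _ _)

end structureTensor

lemma dotProduct_star_comm (x y : Fin m → ℂ) : star x ⬝ᵥ y = conj (star y ⬝ᵥ x) := by
  rw [starRingEnd_apply, Matrix.star_dotProduct]

lemma dotProduct_mulVec_skew {U : Matrix (Fin m) (Fin m) ℂ} (hU : Uᴴ = -U) (x y : Fin m → ℂ) :
    star x ⬝ᵥ (U *ᵥ y) = -conj (star y ⬝ᵥ (U *ᵥ x)) := by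
  have h : U = -Uᴴ := by rw [hU, neg_neg]
  conv_lhs => rw [h]
  rw [Matrix.neg_mulVec, dotProduct_neg, ← dotProduct_star_comm, Matrix.star_mulVec,
    Matrix.dotProduct_mulVec]

/-- Koszul's formula for generators, evaluated at `o`.  The elements `U'`, `U''` of `𝔲(n-1)`, which
only contribute to the isotropy, drop out because they are skew-hermitian. -/
lemma metric_nabla_fundField (hμ : 0 < μ) {nabla : Cov m} (hLC : IsLeviCivita μ nabla)
    {U U' U'' : Matrix (Fin m) (Fin m) ℂ} (hU : Uᴴ = -U) (hU' : U'ᴴ = -U') (hU'' : U''ᴴ = -U'')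
    (θ θ' θ'' a a' a'' b b' b'' : ℝ) (v v' v'' : Fin m → ℂ) :
    metric μ (basePt m) (nabla (fundField (pMat U θ a b v)) (basePt m)
      (ev (pMat U' θ' a' b' v'))) (ev (pMat U'' θ'' a'' b'' v'')) =
      a'' * metric μ (basePt m) (v, -2 * a + b * Complex.I) (v', -2 * a' + b' * Complex.I)
      - a' * metric μ (basePt m) (v, -2 * a + b * Complex.I) (v'', -2 * a'' + b'' * Complex.I)
      + b'' / 2 * metric μ (basePt m) (v, -2 * a + b * Complex.I)
          (Complex.I • (v', -2 * a' + b' * Complex.I))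
      - b' / 2 * metric μ (basePt m) (v, -2 * a + b * Complex.I)
          (Complex.I • (v'', -2 * a'' + b'' * Complex.I))
      - b / 2 * kaehlerForm μ (basePt m) (v', 0) (v'', 0)
      + metric μ (basePt m) (U *ᵥ v' - (θ * Complex.I) • v', 0) (v'', 0) := by
  have h := hLC.koszul hμ (fun p => (hasFDerivAt_fundField U' θ' a' b' v' p).differentiableAt)
    (fun p => (hasFDerivAt_fundField U θ a b v p).differentiableAt)
    (fun p => (hasFDerivAt_fundField U'' θ'' a'' b'' v'' p).differentiableAt)
  rw [fderiv_metric_basePt hμ (hasFDerivAt_fundField _ _ _ _ _ _)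
      (hasFDerivAt_fundField _ _ _ _ _ _),
    fderiv_metric_basePt hμ (hasFDerivAt_fundField _ _ _ _ _ _)
      (hasFDerivAt_fundField _ _ _ _ _ _),
    fderiv_metric_basePt hμ (hasFDerivAt_fundField _ _ _ _ _ _)
      (hasFDerivAt_fundField _ _ _ _ _ _)]
    at h
  simp only [VectorField.lieBracket, (hasFDerivAt_fundField _ _ _ _ _ _).fderiv] at h
  simp only [ev, fundField_basePt, linPart_apply, metric_basePt hμ, kaehlerForm_basePt hμ,
    dotProduct_add, dotProduct_sub, dotProduct_smul, star_add, star_smul, add_dotProduct,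
    smul_dotProduct, Prod.smul_mk, Prod.mk_sub_mk] at h ⊢
  -- the remaining scalar products are expressed through a minimal set of them
  simp only [dotProduct_star_comm (U *ᵥ _), dotProduct_star_comm (U'' *ᵥ _),
    dotProduct_mulVec_skew hU v' v'', dotProduct_mulVec_skew hU' v v'',
    dotProduct_mulVec_skew hU'' v v', dotProduct_star_comm v v', dotProduct_star_comm v v'',
    dotProduct_star_comm v' v''] at h ⊢
  simp at h ⊢
  linear_combination h / 2

/-! ### The complex structure and the isotropy terms -/

lemma metric_add_left (hμ : 0 < μ) (v v' w : Chart m) :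
    metric μ (basePt m) (v + v') w = metric μ (basePt m) v w + metric μ (basePt m) v' w := by
  have h := metric_sub_left hμ (v + v') v' w
  rw [add_sub_cancel_right] at h
  linarith

lemma metric_smul_left (hμ : 0 < μ) (c : ℝ) (v w : Chart m) :
    metric μ (basePt m) (c • v) w = c * metric μ (basePt m) v w := by
  simp only [metric_basePt hμ, Prod.smul_fst, Prod.smul_snd, dotProduct_smul]
  simp
  ring

lemma eq_zero_of_metric_self (hμ : 0 < μ) {v : Chart m} (h : metric μ (basePt m) v v = 0) :
    v = 0 := by
  rw [metric_basePt hμ] at h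
  have h1 : (star v.1 ⬝ᵥ v.1 + v.2 * conj v.2 / 2).re =
      ∑ i, Complex.normSq (v.1 i) + Complex.normSq v.2 / 2 := by
    rw [Complex.mul_conj]
    simp [dotProduct, Complex.normSq_apply]
  have h2 : 0 ≤ ∑ i, Complex.normSq (v.1 i) := Finset.sum_nonneg fun i _ => Complex.normSq_nonneg _
  have h3 := Complex.normSq_nonneg v.2
  rw [h1] at h
  have h4 := (mul_eq_zero.1 h).resolve_left (by positivity)
  have h5 : ∑ i, Complex.normSq (v.1 i) = 0 := by linarith
  have h6 : Complex.normSq v.2 = 0 := by linarith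
  ext i
  · exact Complex.normSq_eq_zero.1
      ((Finset.sum_eq_zero_iff_of_nonneg fun i _ => Complex.normSq_nonneg _).1 h5 i
        (Finset.mem_univ i))
  · exact Complex.normSq_eq_zero.1 h6

lemma kaehlerForm_basePt_eq_metric (hμ : 0 < μ) (v w : Chart m) :
    kaehlerForm μ (basePt m) v w = metric μ (basePt m) v (Complex.I • w) := by
  rw [kaehlerForm_basePt hμ, metric_basePt hμ]
  congr 1
  simp [star_smul, smul_dotProduct]
  ring

lemma lie_pMat_sMat {U : Matrix (Fin m) (Fin m) ℂ} (hU : Uᴴ = -U) (θ : ℝ) (v : Fin m → ℂ) :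
    ⁅pMat U θ 0 0 0, sMat 0 0 v⁆ = sMat 0 0 (U *ᵥ v - (θ * Complex.I) • v) := by
  have hU' : ∀ i j, conj (U i j) = -U j i := fun i j => congrFun (congrFun hU j) i
  rw [Ring.lie_def]
  ext i j
  rcases i with i | i <;> rcases j with j | j
  · simp [pMat, sMat, Matrix.mul_apply]
  · fin_cases j <;> simp [pMat, sMat, Matrix.mul_apply, Matrix.mulVec, dotProduct]
    ring
  · fin_cases i <;> simp [pMat, sMat, Matrix.mul_apply, Matrix.mulVec, dotProduct, hU']
    simp only [mul_comm]
  · fin_cases i <;> fin_cases j <;> simp [pMat, sMat, Matrix.mul_apply]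

lemma ev_lie_pMat (U U' : Matrix (Fin m) (Fin m) ℂ) (θ θ' a b : ℝ) (v : Fin m → ℂ) :
    ev ⁅pMat U θ 0 0 0, pMat U' θ' a b v⁆ = (U *ᵥ v - (θ * Complex.I) • v, 0) := by
  rw [ev_eq, Ring.lie_def]
  ext
  · simp [pMat, Matrix.mul_apply, Matrix.mulVec, dotProduct]; ring
  · simp [pMat, Matrix.mul_apply]; ring

section complement

variable {F : Subgroup (GLn m)} {𝔪 : Submodule ℝ (Mat m)} {Hr : Mat m}

/-- In the affine chart the complex structure of `𝔪` is multiplication by `i`. -/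
lemma Jm_spec (hμ : 0 < μ) (h𝔪 : IsReductiveComplement F 𝔪) (hHr : IsHr F Hr) (B : Mat m) :
    Jm μ 𝔪 B ∈ 𝔪 ∧ ev (Jm μ 𝔪 B) = Complex.I • ev B := by
  obtain ⟨Z₀, hZ₀, hev⟩ := exists_mem_ev_eq h𝔪 hHr (Complex.I • ev B)
  obtain ⟨hZ, h⟩ := Classical.epsilon_spec (p := fun Z => Z ∈ 𝔪 ∧ ∀ X ∈ 𝔪, om μ X B = gm μ X Z)
    ⟨Z₀, hZ₀, fun X _ => by rw [om, gm, hev, kaehlerForm_basePt_eq_metric hμ]⟩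
  refine ⟨hZ, ?_⟩
  obtain ⟨X, hX, hXe⟩ := exists_mem_ev_eq h𝔪 hHr (ev (Jm μ 𝔪 B) - Complex.I • ev B)
  have h1 : om μ X B = gm μ X (Jm μ 𝔪 B) := h X hX
  rw [om, gm, kaehlerForm_basePt_eq_metric hμ, hXe, eq_comm, ← sub_eq_zero,
    ← metric_sub_right hμ] at h1
  exact sub_eq_zero.1 (eq_zero_of_metric_self hμ h1)

lemma coefα_Jm (hμ : 0 < μ) (hF : IsTransitiveFactor F) (h𝔪 : IsReductiveComplement F 𝔪)
    (hHr : IsHr F Hr) (U : Matrix (Fin m) (Fin m) ℂ) (θ a b : ℝ) (v : Fin m → ℂ) :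
    coefα (Jm μ 𝔪 (pMat U θ a b v)) = b / 2 := by
  obtain ⟨hJ, he⟩ := Jm_spec hμ h𝔪 hHr (pMat U θ a b v)
  obtain ⟨U', θ', a', b', v', -, h⟩ := lieAlg_groupG hF.le (h𝔪.mem_lieAlg hJ)
  rw [h, ev_pMat, ev_pMat] at he
  have := congrArg (fun x => x.2.re) he
  simp at this
  rw [h, coefα_pMat]
  linarith

/-- The last two terms of the formula add up to the action on `X_C` of the block diagonal part
of `B`. -/
lemma gm_lie_primeOf_add_gm_subr (hμ : 0 < μ) (hF : IsTransitiveFactor F)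
    (h𝔪 : IsReductiveComplement F 𝔪) (hHr : IsHr F Hr) {U U' : Matrix (Fin m) (Fin m) ℂ}
    {θ θ' a a' b b' : ℝ} {v v' : Fin m → ℂ} (hB : pMat U θ a b v ∈ 𝔪) (D : Mat m) :
    gm μ ⁅primeOf F 𝔪 Hr (pMat U θ a b v), pMat U' θ' a' b' v'⁆ D
      + a * gm μ (subr F 𝔪 Hr (pMat U' θ' a' b' v')) D =
    metric μ (basePt m) (U *ᵥ v' - (θ * Complex.I) • v', 0) (ev D) := by
  obtain ⟨V, ξ, hV, hH⟩ := lieAlg_groupM hHr.mem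
  have hsub : ev (subr F 𝔪 Hr (pMat U' θ' a' b' v')) = ev ⁅Hr, pMat U' θ' a' b' v'⁆ := by
    have h : ⁅Hr, compX (pMat U' θ' a' b' v')⁆ = sMat 0 0 (V *ᵥ v' - (ξ * Complex.I) • v') := by
      rw [hH, compX_pMat, lie_pMat_sMat hV]
    rw [subr, h, ev_tilde h𝔪 hHr, hH, ev_lie_pMat]
    simp
  have hlie : ⁅primeOf F 𝔪 Hr (pMat U θ a b v), pMat U' θ' a' b' v'⁆
      + a • ⁅Hr, pMat U' θ' a' b' v'⁆ =
      ⁅primeOf F 𝔪 Hr (pMat U θ a b v) + a • Hr, pMat U' θ' a' b' v'⁆ := by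
    simp only [Ring.lie_def, add_mul, mul_add, smul_sub, smul_mul_assoc, mul_smul_comm]
    abel
  rw [gm, gm, hsub, ← metric_smul_left hμ, ← metric_add_left hμ, ← ev_smul, ← ev_add,
    hlie, primeOf_add hF h𝔪 hHr hB, ev_lie_pMat]

end complement

end CHyp

open CHyp in
theorem mainTheorem3 (m : ℕ) (μ : ℝ) (hμ : 0 < μ)
    (F : Subgroup (GLn m)) (hF : IsTransitiveFactor F)
    (𝔪 : Submodule ℝ (Mat m)) (h𝔪 : IsReductiveComplement F 𝔪)
    (Hr : Mat m) (hHr : IsHr F Hr)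
    (nabla nablaTilde : Cov m) (hLC : IsLeviCivita μ nabla)
    (hcan : IsCanonicalConnection F 𝔪 nablaTilde) :
    -- `B ↦ B*_o` identifies `𝔪` with the tangent space at `o`
    Function.Bijective (fun B : 𝔪 => ev (B : Mat m)) ∧
    -- the coefficients of an element of `𝔪`
    (∀ B ∈ 𝔪, B = coefα B • tilde F 𝔪 Hr (A₀ m) + coefη B • tilde F 𝔪 Hr (N₂ m)
      + tilde F 𝔪 Hr (compX B)) ∧
    -- the formula for the homogeneous structure tensor
    ∀ B ∈ 𝔪, ∀ C ∈ 𝔪, ∀ D ∈ 𝔪,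
      metric μ (basePt m)
          (structureTensor hLC.isConnection hcan.isConnection (basePt m) (ev B) (ev C)) (ev D)
        = coefα D * gm μ B C - coefα C * gm μ B D
          + coefα (Jm μ 𝔪 D) * gm μ B (Jm μ 𝔪 C) - coefα (Jm μ 𝔪 C) * gm μ B (Jm μ 𝔪 D)
          - coefα (Jm μ 𝔪 B) * om μ (tilde F 𝔪 Hr (compX C)) (tilde F 𝔪 Hr (compX D))
          + gm μ ⁅primeOf F 𝔪 Hr B, C⁆ D + coefα B * gm μ (subr F 𝔪 Hr C) D := by
  refine ⟨ev_bijective hF h𝔪 hHr, fun B hB => eq_sum_tilde hF h𝔪 hHr hB, ?_⟩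
  intro B hB C hC D hD
  rw [structureTensor_ev hF h𝔪 hLC hcan hB hC]
  obtain ⟨U, θ, a, b, v, hU, rfl⟩ := lieAlg_groupG hF.le (h𝔪.mem_lieAlg hB)
  obtain ⟨U', θ', a', b', v', hU', rfl⟩ := lieAlg_groupG hF.le (h𝔪.mem_lieAlg hC)
  obtain ⟨U'', θ'', a'', b'', v'', hU'', rfl⟩ := lieAlg_groupG hF.le (h𝔪.mem_lieAlg hD)
  rw [metric_nabla_fundField hμ hLC hU hU' hU'', add_assoc, coefα_pMat, coefα_pMat, coefα_pMat,
    gm_lie_primeOf_add_gm_subr hμ hF h𝔪 hHr hB, coefα_Jm hμ hF h𝔪 hHr, coefα_Jm hμ hF h𝔪 hHr,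
    coefα_Jm hμ hF h𝔪 hHr, compX_pMat, compX_pMat, om, ev_tilde h𝔪 hHr, ev_tilde h𝔪 hHr]
  simp only [gm, (Jm_spec hμ h𝔪 hHr _).2, ev_pMat]
  -- `v''` may be completed to `D*_o`, as its first argument has no second component
  have hv : metric μ (basePt m) (U *ᵥ v' - (θ * Complex.I) • v', 0) (v'', 0) =
      metric μ (basePt m) (U *ᵥ v' - (θ * Complex.I) • v', 0)
        (v'', -2 * a'' + b'' * Complex.I) := by
    simp [metric_basePt hμ]
  rw [hv]
  simp
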